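/- **Setting.** Let $q>2$, $\sigma(z)=\max\{0,z\}^q$, $\ell(z)=\log(1+e^{-z})$, $\mathbf v\in\mathbb R^d\setminus\{0\}$, $\sigma_\xi>0$ and $\mathbf H=\mathbf I-\mathbf v\mathbf v^\top/\|\mathbf v\|_2^2$. The data distribution $\mathcal D$ is the law of $(\mathbf x,y)$ with $y$ uniform on $\{\pm1\}$, $\mathbf x=[\mathbf x_1,\mathbf x_2]=[y\mathbf v,\boldsymbol\xi]$ and $\boldsymbol\xi\sim\mathcal N(0,\sigma_\xi^2\mathbf H)$ independent of $y$. The network is $f(\mathbf W,\mathbf x)=F_{+1}(\mathbf W_{+1},\mathbf x)-F_{-1}(\mathbf W_{-1},\mathbf x)$ with $F_j(\mathbf W_j,\mathbf x)=\frac1m\sum_{r=1}^m[\sigma(\langle \mathbf w_{j,r},\mathbf x_1\rangle)+\sigma(\langle \mathbf w_{j,r},\mathbf x_2\rangle)]$. From i.i.d. samples $D=\{(\mathbf x_i,y_i)\}_{i\le n}$ of $\mathcal D$ put $L_D(\mathbf W)=\frac1n\sum_i\ell(y_if(\mathbf W,\mathbf x_i))$. Noisy gradient descent starts from i.i.d.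 $\mathcal N(0,\sigma_0^2)$ entries and runs $\mathbf w_{j,r}^{(t+1)}=\mathbf w_{j,r}^{(t)}-\eta(\nabla_{\mathbf w_{j,r}}L_D(\mathbf W^{(t)})+\mathbf z_t)$ with $\eta>0$; here $\mathbf z_t\sim\mathcal N(0,\sigma_z^2\mathbf I_d)$ at every filter, i.i.d. over $t$ (one vector shared by all filters, or one vector per filter with any joint law), and data, initialization and noise are independent. Write $\|\boldsymbol\xi\|_2$ for its typical size $\sigma_\xi\sqrt d$, $\mathrm{SNR}=\|\mathbf v\|_2/\|\boldsymbol\xi\|_2$ and $\mu=\max\{1,\|\mathbf v\|_2,\|\boldsymbol\xi\|_2\}$. For $T$ iterations and privacy parameters $\varepsilon>0$, $\delta\in(0,1)$, $\log(1/\delta)=\widetilde O(1)$, the noise is that of the Gaussian mechanism with gradient sensitivity $C_s(\|\mathbf v\|_2+\|\boldsymbol\xi\|_2)/(nm)$, $0<C_s=\widetilde O(1)$: $$\sigma_z=\frac{\sqrt T\,C_s(\|\mathbf v\|_2+\|\boldsymbol\xi\|_2)}{nm\,\varepsilon}\sqrt{2\log(1.25/\delta)},\qquad T\le\widetilde O(1)\cdot\frac{mn\varepsilon\sigma_0}{\eta\mu(\|\mathbf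 v\|_2+\|\boldsymbol\xi\|_2)} .$$ **Conditions.** $d\ge\widetilde\Omega(m^{2\vee[4/(q-2)]}n^{4\vee[(2q-2)/(q-2)]})$; $n,m\ge\Omega(\mathrm{polylog}(d))$; $\eta\le\widetilde O(\min\{\|\mathbf v\|_2^{-2},\|\boldsymbol\xi\|_2^{-2}\})$; $\varepsilon\ge 1/\sqrt n$; and $$\widetilde O((n\varepsilon)^{-1/q}\|\mathbf v\|_2^{-1})\le\sigma_0\le\widetilde O\big(\min\{\varepsilon^{-1/q}\|\boldsymbol\xi\|_2^{-1},\,n^{-1/(2q)}\|\mathbf v\|_2^{-1},\,(n\varepsilon)^{-(q+1)/q}\|\boldsymbol\xi\|_2^{-1}\}\big).$$ **Claim.** Suppose moreover $\mathrm{SNR}\cdot n\varepsilon\ge\widetilde\Omega(1)$ and $(n\varepsilon)^{1+1/q}\ge\widetilde\Omega(1)$. Let $\kappa>0$. Then, with probability at least $1-1/d$, every iterate $t\le T$ with $L_D(\mathbf W^{(t)})\le O(\kappa)$ satisfies $$L_{\mathcal D}(\mathbf W^{(t)})\le O\big(\kappa+\exp(-(n\varepsilon)^{1+1/q})\big),$$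 both for the test error $L_{\mathcal D}(\mathbf W)=\mathbb P_{(\mathbf x,y)\sim\mathcal D}[y f(\mathbf W,\mathbf x)<0]$ and for the logistic test loss $L_{\mathcal D}(\mathbf W)=\mathbb E_{(\mathbf x,y)\sim\mathcal D}[\ell(yf(\mathbf W,\mathbf x))]$. **Constants.** Precisely: for every $q>2$ and $C_0>0$ there is $C>0$ such that for every $B>0$ there is $K>0$ for which the following holds for all values of the other parameters. If $C_s$, $\log(1/\delta)$ and the factor $\widetilde O(1)$ in the bound on $T$ are at most $B(1+\log d)^B$, and all conditions hold with every hidden factor equal to $\Lambda=K(1+\log d)^K$ (lower bounds multiplied by $\Lambda$, upper bounds divided by $\Lambda$), then for every $\kappa>0$, with probability at least $1-1/d$, every $t\le T$ with $L_D(\mathbf W^{(t)})\le C_0\kappa$ has both test losses at most $C(\kappa+\exp(-(n\varepsilon)^{1+1/q}))$. -/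

import Mathlib

open MeasureTheory ProbabilityTheory
open scoped ENNReal

namespace PrivateCNN

noncomputable section

/-! ### Data distribution -/

/-- The ambient space `ℝ^d` with its Euclidean norm. -/
abbrev Vec (d : ℕ) := EuclideanSpace ℝ (Fin d)

/-- An input with two patches `x = [x₁, x₂] ∈ (ℝ^d)²` together with a label;
`true` stands for the label `+1` and `false` for the label `-1`. -/
abbrev Datum (d : ℕ) := (Vec d × Vec d) × Bool

/-- The numerical value `±1` of a label or of an output sign `j`. -/
def sgn (b : Bool) : ℝ := if b then 1 else -1

/-- The uniform (Rademacher) law on the two signs. -/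
def rademacher : Measure Bool :=
  (2⁻¹ : ℝ≥0∞) • Measure.dirac true + (2⁻¹ : ℝ≥0∞) • Measure.dirac false

instance : IsProbabilityMeasure rademacher :=
  ⟨by simp [rademacher, ENNReal.inv_two_add_inv_two]⟩

/-- `H = I - v vᵀ / ‖v‖²`. -/
def projMatrix {d : ℕ} (v : Vec d) : Matrix (Fin d) (Fin d) ℝ :=
  1 - (‖v‖ ^ 2)⁻¹ • Matrix.vecMulVec v.ofLp v.ofLp

/-- The covariance `s² H` is positive semidefinite. -/
theorem posSemidef_projMatrix {d : ℕ} (v : Vec d) (s : ℝ) :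
    (s ^ 2 • projMatrix v).PosSemidef := by
  have key : projMatrix v = (projMatrix v).conjTranspose * projMatrix v := by
    have hs : (projMatrix v).conjTranspose = projMatrix v := by
      ext i j
      simp [projMatrix, Matrix.vecMulVec_apply, Matrix.one_apply, eq_comm, mul_comm]
    rw [hs]
    have hd : v.ofLp ⬝ᵥ v.ofLp = ‖v‖ ^ 2 := by
      rw [EuclideanSpace.real_norm_sq_eq]
      simp [dotProduct, sq]
    have hvv : Matrix.vecMulVec v.ofLp v.ofLp * Matrix.vecMulVec v.ofLp v.ofLp =
        ‖v‖ ^ 2 • Matrix.vecMulVec v.ofLp v.ofLp := by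
      rw [Matrix.vecMulVec_mul_vecMulVec, hd]
      ext i j
      simp [Matrix.vecMulVec_apply]
      ring
    by_cases h : ‖v‖ = 0
    · simp [projMatrix, h]
    · simp only [projMatrix, sub_mul, mul_sub, one_mul, mul_one, Matrix.smul_mul,
        Matrix.mul_smul, hvv, smul_smul]
      have : (‖v‖ ^ 2)⁻¹ * ((‖v‖ ^ 2)⁻¹ * ‖v‖ ^ 2) = (‖v‖ ^ 2)⁻¹ := by
        field_simp
      rw [this]
      abel
  rw [key]
  exact (Matrix.posSemidef_conjTranspose_mul_self _).smul (sq_nonneg s)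

/-- The law `N(0, σξ² H)` of the data noise. -/
def dataNoise {d : ℕ} (v : Vec d) (σξ : ℝ) : Measure (Vec d) :=
  multivariateGaussian 0 (σξ ^ 2 • projMatrix v)

/-- The law `N(0, s² I)` on `ℝ^d`. -/
def isoGaussian (d : ℕ) (s : ℝ) : Measure (Vec d) :=
  multivariateGaussian 0 (s ^ 2 • (1 : Matrix (Fin d) (Fin d) ℝ))

instance {d : ℕ} (v : Vec d) (σξ : ℝ) : IsProbabilityMeasure (dataNoise v σξ) := by
  unfold dataNoise; infer_instance

instance (d : ℕ) (s : ℝ) : IsProbabilityMeasure (isoGaussian d s) := by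
  unfold isoGaussian; infer_instance

/-- The data distribution: `y` is a Rademacher label, `ξ ∼ N(0, σξ² H)` is independent of `y`,
and the input is `x = [y v, ξ]`. -/
def dataLaw {d : ℕ} (v : Vec d) (σξ : ℝ) : Measure (Datum d) :=
  (rademacher.prod (dataNoise v σξ)).map fun p => ((sgn p.1 • v, p.2), p.1)

instance {d : ℕ} (v : Vec d) (σξ : ℝ) : IsProbabilityMeasure (dataLaw v σξ) := by
  unfold dataLaw
  refine Measure.isProbabilityMeasure_map (Measurable.aemeasurable ?_)
  have h : Measurable fun b : Bool => sgn b • v := measurable_from_top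
  exact ((h.comp measurable_fst).prodMk measurable_snd).prodMk measurable_fst

/-! ### The two-layer convolutional network and the losses -/

/-- The weights: one filter `w_{j,r} ∈ ℝ^d` for every sign `j` and every `r ∈ [m]`. -/
abbrev Weights (d m : ℕ) := Bool × Fin m → Vec d

/-- The polynomial ReLU `σ(z) = max{0, z}^q`. -/
def act (q z : ℝ) : ℝ := max 0 z ^ q

/-- `F_j(W_j, x) = (1/m) ∑_r [σ(⟨w_{j,r}, x₁⟩) + σ(⟨w_{j,r}, x₂⟩)]`. -/
def netF {d m : ℕ} (q : ℝ) (W : Weights d m) (j : Bool) (x : Vec d × Vec d) : ℝ :=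
  (1 / (m : ℝ)) * ∑ r, (act q (inner ℝ (W (j, r)) x.1) + act q (inner ℝ (W (j, r)) x.2))

/-- `f(W, x) = F_{+1}(W_{+1}, x) - F_{-1}(W_{-1}, x)`. -/
def net {d m : ℕ} (q : ℝ) (W : Weights d m) (x : Vec d × Vec d) : ℝ :=
  netF q W true x - netF q W false x

/-- The logistic loss `ℓ(z) = log(1 + exp(-z))`. -/
def logistic (z : ℝ) : ℝ := Real.log (1 + Real.exp (-z))

/-- The margin `y · f(W, x)`. -/
def margin {d m : ℕ} (q : ℝ) (W : Weights d m) (p : Datum d) : ℝ := sgn p.2 * net q W p.1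

/-- The training loss `L_D(W) = (1/n) ∑_i ℓ(y_i f(W, x_i))`. -/
def trainLoss {d n m : ℕ} (q : ℝ) (D : Fin n → Datum d) (W : Weights d m) : ℝ :=
  (1 / (n : ℝ)) * ∑ i, logistic (margin q W (D i))

/-- The test error `P_{(x,y) ∼ 𝒟}[y f(W, x) < 0]`. -/
def testError {d m : ℕ} (q : ℝ) (v : Vec d) (σξ : ℝ) (W : Weights d m) : ℝ :=
  (dataLaw v σξ).real {p | margin q W p < 0}

/-- The population logistic risk `E_{(x,y) ∼ 𝒟}[ℓ(y f(W, x))]`, as an element of `[0, ∞]`. -/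
def testRisk {d m : ℕ} (q : ℝ) (v : Vec d) (σξ : ℝ) (W : Weights d m) : ℝ≥0∞ :=
  ∫⁻ p, ENNReal.ofReal (logistic (margin q W p)) ∂(dataLaw v σξ)

/-! ### Noisy gradient descent -/

/-- The partial gradient `∇_{w_{j,r}} L_D(W)`, with `a = (j, r)`. -/
def gradFilter {d n m : ℕ} (q : ℝ) (D : Fin n → Datum d) (W : Weights d m) (a : Bool × Fin m) :
    Vec d :=
  gradient (fun u : Vec d => trainLoss q D (Function.update W a u)) (W a)

/-- The iterates
`w_{j,r}^{(t+1)} = w_{j,r}^{(t)} - η (∇_{w_{j,r}} L_D(W^{(t)}) + z_{t,j,r})`. -/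
def noisyGD {d n m : ℕ} (q η : ℝ) (D : Fin n → Datum d) (W₀ : Weights d m)
    (z : ℕ → Weights d m) : ℕ → Weights d m
  | 0 => W₀
  | t + 1 => fun a =>
      noisyGD q η D W₀ z t a - η • (gradFilter q D (noisyGD q η D W₀ z t) a + z t a)

/-- All the randomness of a training run: the training set, the initialization and the sequence of
privacy noises. -/
abbrev Run (d n m : ℕ) := (Fin n → Datum d) × Weights d m × (ℕ → Weights d m)

/-- The iterate `W^{(t)}` of a training run. -/
def iterate {d n m : ℕ} (q η : ℝ) (ω : Run d n m) (t : ℕ) : Weights d m :=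
  noisyGD q η ω.1 ω.2.1 ω.2.2 t

/-- The law of a training run: `n` i.i.d. samples of the data distribution, an independent
initialization with i.i.d. `N(0, σ₀²)` entries, and independent privacy noises, i.i.d. over the
iterations with law `ν` (a law on the noise vectors of all filters at one iteration). -/
def runLaw {d m : ℕ} (n : ℕ) (v : Vec d) (σξ σ₀ : ℝ) (ν : Measure (Weights d m))
    [IsProbabilityMeasure ν] : Measure (Run d n m) :=
  (Measure.pi fun _ : Fin n => dataLaw v σξ).prod
    ((Measure.pi fun _ : Bool × Fin m => isoGaussian d σ₀).prod
      (Measure.infinitePi fun _ : ℕ => ν))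

/-! ### Parameters -/

/-- The typical size `σξ √d` of `‖ξ‖₂`. -/
def noiseNorm (d : ℕ) (σξ : ℝ) : ℝ := σξ * √(d : ℝ)

/-- The signal-to-noise ratio `‖v‖₂ / ‖ξ‖₂`. -/
def snr {d : ℕ} (v : Vec d) (σξ : ℝ) : ℝ := ‖v‖ / noiseNorm d σξ

/-- A polylogarithmic factor in `d`, as hidden in `Õ` and `Ω̃`. -/
def polylog (K : ℝ) (d : ℕ) : ℝ := K * (1 + Real.log d) ^ K

/-- The standard deviation of the Gaussian mechanism for `T` iterations with privacy parameters
`(ε, δ)`, when the gradient has `ℓ₂`-sensitivity `Cs (‖v‖₂ + ‖ξ‖₂) / (n m)`. -/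
def privacyStd {d : ℕ} (n m T : ℕ) (v : Vec d) (σξ ε δ Cs : ℝ) : ℝ :=
  √(T : ℝ) * (Cs * (‖v‖ + noiseNorm d σξ) / (n * m)) * √(2 * Real.log (1.25 / δ)) / ε

/-- The private iteration budget `m n ε σ₀ / (η μ (‖v‖₂ + ‖ξ‖₂))` with
`μ = max{1, ‖v‖₂, ‖ξ‖₂}`. -/
def privateBudget {d : ℕ} (n m : ℕ) (v : Vec d) (σξ ε η σ₀ : ℝ) : ℝ :=
  m * n * ε * σ₀ /
    (η * max 1 (max ‖v‖ (noiseNorm d σξ)) * (‖v‖ + noiseNorm d σξ))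

/-- The conditions of signal learning; `Λ` is the polylogarithmic factor hidden in `Õ`, `Ω̃`. -/
structure SignalLearning {d : ℕ} (q Λ : ℝ) (n m : ℕ) (v : Vec d) (σξ ε η σ₀ : ℝ) : Prop where
  signal_ne_zero : v ≠ 0
  noise_pos : 0 < σξ
  lr_pos : 0 < η
  init_pos : 0 < σ₀
  dim_ge : Λ * (m : ℝ) ^ max 2 (4 / (q - 2)) * (n : ℝ) ^ max 4 ((2 * q - 2) / (q - 2)) ≤ d
  samples_ge : Λ ≤ n
  width_ge : Λ ≤ m
  lr_le : η ≤ Λ⁻¹ * min (‖v‖ ^ (-2 : ℝ)) (noiseNorm d σξ ^ (-2 : ℝ))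
  init_ge : Λ * ((n * ε) ^ (-1 / q) * ‖v‖⁻¹) ≤ σ₀
  init_le : σ₀ ≤ Λ⁻¹ * min (ε ^ (-1 / q) * (noiseNorm d σξ)⁻¹)
    (min ((n : ℝ) ^ (-1 / (2 * q)) * ‖v‖⁻¹)
      ((n * ε) ^ ((-q - 1) / q) * (noiseNorm d σξ)⁻¹))
  privacy_pos : 0 < ε
  privacy_ge : 1 / √(n : ℝ) ≤ ε

end

end PrivateCNN

/-!
The private iteration budget is so small that the filters never leave the scale of their
initialization in the noise directions, and this makes the conclusion a matter of concentration;
the dynamics along the signal `v` plays no role.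

Write `N` for `‖ξ‖₂`. Up to polylogarithmic factors, the initial correlations `⟨w, ξ_i⟩` are of
size `σ₀ N`. By the choice of the Gaussian mechanism and of the budget, the accumulated privacy
noise `η ∑ z_s` has standard deviation at most `σ₀`, so it does not change this scale; since `T` is
not polynomially bounded in `d`, the uniformity in `t ≤ T` comes from Doob's maximal inequality
(`measure_exists_abs_sum_gt_le`). The gradient steps add a multiple of `v` and a combination of the
`ξ_i` with coefficients proportional to `|⟨w, ξ_i⟩| ^ (q - 1)` (`exists_gradFilter_eq`). As long as
the correlations are at most `ρ ≈ σ₀ N`, the total drift in `⟨w, ξ_i⟩` is at most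
`n ε ρ ^ (q - 1) · ρ`, which is at most `ρ` because `σ₀ N ≪ (n ε) ^ (-(1 + 1 / q))`
(`gradient_drift_le`). An induction on `t` closes the loop (`noisyGD_decomposition`,
`TypicalRun.iterate_bounds`): for all `t ≤ T`, both `⟨w, ξ_i⟩` and the standard deviation of
`⟨w, ξ⟩` for a fresh noise `ξ` are smaller than `1 / X`, where `X = (n ε) ^ (1 + 1 / q)`.

Consequently the margin of a training datum agrees, up to a bounded error, with the contribution of
the signal patch, which depends on the label only. As both labels occur with frequency at least
`1 / 4`, the training loss controls the logistic loss of both signal margins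
(`logistic_signalMargin_le`). For a test datum the noise patch contributes more than a constant only
on an event where `|⟨w, ξ⟩| > 1`; as `⟨w, ξ⟩` is Gaussian with standard deviation below `1 / X`,
this costs `exp (-X)` (`testRisk_le`). The test error follows by Markov's inequality.
-/

namespace PrivateCNN

/-! ### Gaussian projections and tail bounds -/

theorem hasSubgaussianMGF_mono {Ω : Type*} {mΩ : MeasurableSpace Ω} {μ : Measure Ω} {X : Ω → ℝ}
    {c c' : NNReal} (h : HasSubgaussianMGF X c μ) (hc : c ≤ c') : HasSubgaussianMGF X c' μ where
  integrable_exp_mul := h.integrable_exp_mul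
  mgf_le t := (h.mgf_le t).trans (by gcongr)

theorem map_inner_multivariateGaussian {d : ℕ} {S : Matrix (Fin d) (Fin d) ℝ} (hS : S.PosSemidef)
    (u : Vec d) :
    (multivariateGaussian 0 S).map (fun x => inner ℝ u x) =
      gaussianReal 0 (u.ofLp ⬝ᵥ S.mulVec u.ofLp).toNNReal := by
  have h := IsGaussian.map_eq_gaussianReal (μ := multivariateGaussian (0 : Vec d) S)
    (innerSL ℝ u)
  have h1 : ∫ x, (innerSL ℝ u) x ∂(multivariateGaussian (0 : Vec d) S) = 0 := by
    rw [(innerSL ℝ u).integral_comp_id_comm IsGaussian.integrable_id,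
      integral_id_multivariateGaussian, map_zero]
  have h2 : Var[innerSL ℝ u; multivariateGaussian (0 : Vec d) S] =
      u.ofLp ⬝ᵥ S.mulVec u.ofLp := by
    rw [← covarianceBilin_multivariateGaussian (μ := (0 : Vec d)) hS,
      covarianceBilin_self IsGaussian.memLp_two_id]
    rfl
  rw [h1, h2] at h
  exact h

theorem hasSubgaussianMGF_inner_multivariateGaussian {d : ℕ} {S : Matrix (Fin d) (Fin d) ℝ}
    (hS : S.PosSemidef) (u : Vec d) {c : NNReal} (hc : u.ofLp ⬝ᵥ S.mulVec u.ofLp ≤ c) :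
    HasSubgaussianMGF (fun x => inner ℝ u x) c (multivariateGaussian 0 S) := by
  have hm : Measurable (fun x : Vec d => inner ℝ u x) := by fun_prop
  have key : HasSubgaussianMGF (fun x : ℝ => x) c
      ((multivariateGaussian (0 : Vec d) S).map (fun x => inner ℝ u x)) := by
    rw [map_inner_multivariateGaussian hS u]
    refine hasSubgaussianMGF_mono (c := (u.ofLp ⬝ᵥ S.mulVec u.ofLp).toNNReal)
      ⟨fun t => integrable_exp_mul_gaussianReal t, fun t => ?_⟩ (by
        rw [Real.toNNReal_le_iff_le_coe]; exact hc)
    rw [mgf_fun_id_gaussianReal]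
    simp
  exact (HasSubgaussianMGF.id_map_iff hm.aemeasurable).1 key

theorem integral_inner_multivariateGaussian {d : ℕ} {S : Matrix (Fin d) (Fin d) ℝ} (u : Vec d) :
    ∫ x, inner ℝ u x ∂(multivariateGaussian (0 : Vec d) S) = 0 := by
  have := (innerSL ℝ u).integral_comp_id_comm
    (IsGaussian.integrable_id (μ := multivariateGaussian (0 : Vec d) S))
  rw [integral_id_multivariateGaussian, map_zero] at this
  exact this

theorem dotProduct_ofLp_self {d : ℕ} (u : Vec d) : u.ofLp ⬝ᵥ u.ofLp = ‖u‖ ^ 2 := by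
  rw [EuclideanSpace.real_norm_sq_eq]; simp [dotProduct, sq]

/-- `H ≤ I` as quadratic forms. -/
theorem dotProduct_projMatrix_le {d : ℕ} (v u : Vec d) :
    u.ofLp ⬝ᵥ (projMatrix v).mulVec u.ofLp ≤ ‖u‖ ^ 2 := by
  have h := dotProduct_ofLp_self u
  rw [projMatrix, Matrix.sub_mulVec, Matrix.one_mulVec, dotProduct_sub, h, Matrix.smul_mulVec,
    Matrix.vecMulVec_mulVec, dotProduct_smul, dotProduct_smul]
  have : 0 ≤ (‖v‖ ^ 2)⁻¹ * (v.ofLp ⬝ᵥ u.ofLp) ^ 2 := by positivity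
  have h2 := dotProduct_comm u.ofLp v.ofLp
  simp only [smul_eq_mul, MulOpposite.smul_eq_mul_unop, MulOpposite.unop_op, h2]
  nlinarith

theorem dotProduct_projMatrix_self {d : ℕ} {v : Vec d} (hv : v ≠ 0) :
    v.ofLp ⬝ᵥ (projMatrix v).mulVec v.ofLp = 0 := by
  have h := dotProduct_ofLp_self v
  have hn : ‖v‖ ≠ 0 := norm_ne_zero_iff.2 hv
  rw [projMatrix, Matrix.sub_mulVec, Matrix.one_mulVec, dotProduct_sub, h, Matrix.smul_mulVec,
    Matrix.vecMulVec_mulVec, dotProduct_smul, dotProduct_smul]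
  simp only [smul_eq_mul, MulOpposite.smul_eq_mul_unop, MulOpposite.unop_op, h]
  field_simp
  ring

theorem hasSubgaussianMGF_inner_dataNoise {d : ℕ} (v u : Vec d) (σξ : ℝ) {c : NNReal}
    (hc : σξ ^ 2 * ‖u‖ ^ 2 ≤ c) :
    HasSubgaussianMGF (fun x => inner ℝ u x) c (dataNoise v σξ) := by
  refine hasSubgaussianMGF_inner_multivariateGaussian (posSemidef_projMatrix v σξ) u (le_trans ?_ hc)
  rw [Matrix.smul_mulVec, dotProduct_smul, smul_eq_mul]
  exact mul_le_mul_of_nonneg_left (dotProduct_projMatrix_le v u) (sq_nonneg _)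

/-- The data noise is orthogonal to the signal: `H v = 0`, so `⟨v, ξ⟩` has variance zero. -/
theorem ae_inner_dataNoise_eq_zero {d : ℕ} {v : Vec d} (hv : v ≠ 0) (σξ : ℝ) :
    ∀ᵐ ξ ∂(dataNoise v σξ), inner ℝ v ξ = 0 := by
  refine (hasSubgaussianMGF_inner_multivariateGaussian (posSemidef_projMatrix v σξ) v (c := 0)
    ?_).ae_eq_zero_of_hasSubgaussianMGF_zero
  rw [Matrix.smul_mulVec, dotProduct_smul, dotProduct_projMatrix_self hv]
  simp

theorem posSemidef_smul_one (d : ℕ) (s : ℝ) :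
    (s ^ 2 • (1 : Matrix (Fin d) (Fin d) ℝ)).PosSemidef :=
  Matrix.PosSemidef.one.smul (sq_nonneg s)

theorem hasSubgaussianMGF_inner_isoGaussian {d : ℕ} (u : Vec d) (s : ℝ) {c : NNReal}
    (hc : s ^ 2 * ‖u‖ ^ 2 ≤ c) :
    HasSubgaussianMGF (fun x => inner ℝ u x) c (isoGaussian d s) := by
  refine hasSubgaussianMGF_inner_multivariateGaussian (posSemidef_smul_one d s) u (le_trans ?_ hc)
  have h := dotProduct_ofLp_self u
  rw [Matrix.smul_mulVec, dotProduct_smul, smul_eq_mul, Matrix.one_mulVec, h]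

theorem exp_half_le_two : Real.exp (1 / 2) ≤ 2 := by
  rw [← Real.le_log_iff_exp_le two_pos]
  have := Real.log_two_gt_d9
  linarith

/-- A two-sided tail bound with rate `β` instead of `β ^ 2 / 2`, which is the form shared with the
maximal inequality below. The scale `s` may exceed the standard deviation, so `c = 0` is allowed. -/
theorem measure_abs_gt_le {Ω : Type*} {mΩ : MeasurableSpace Ω} {μ : Measure Ω}
    [IsProbabilityMeasure μ] {X : Ω → ℝ} {c : NNReal} (h : HasSubgaussianMGF X c μ) {s β : ℝ}
    (hs : 0 < s) (hc : c ≤ s ^ 2) (hβ : 2 ≤ β) :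
    μ {ω | β * s < |X ω|} ≤ ENNReal.ofReal (4 * Real.exp (-β)) := by
  have h' : HasSubgaussianMGF X (s ^ 2).toNNReal μ :=
    hasSubgaussianMGF_mono h (by rw [← NNReal.coe_le_coe, Real.coe_toNNReal _ (sq_nonneg s)]; exact hc)
  have hb : 0 ≤ β * s := by positivity
  have e : Real.exp (-(β * s) ^ 2 / (2 * ((s ^ 2).toNNReal : ℝ))) ≤ Real.exp (-β) := by
    rw [Real.coe_toNNReal _ (sq_nonneg s), Real.exp_le_exp]
    have : -(β * s) ^ 2 / (2 * s ^ 2) = -(β ^ 2 / 2) := by field_simp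
    rw [this]; nlinarith
  have a1 := (h'.measure_ge_le hb).trans e
  have a2 := (h'.neg.measure_ge_le hb).trans e
  have hsub : {ω | β * s < |X ω|} ⊆ {ω | β * s ≤ X ω} ∪ {ω | β * s ≤ (-X) ω} := by
    intro ω hω
    rcases lt_abs.1 (show β * s < |X ω| from hω) with h | h
    · exact Or.inl h.le
    · exact Or.inr h.le
  rw [← ENNReal.ofReal_toReal (measure_ne_top μ _)]
  refine ENNReal.ofReal_le_ofReal ?_
  have := (measureReal_mono hsub (h₂ := measure_ne_top _ _)).trans (measureReal_union_le (μ := μ) _ _)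
  have := Real.exp_pos (-β)
  change μ.real _ ≤ _
  linarith

/-- Chernoff's bound for the running maximum of a sum of independent centred sub-Gaussian
variables: Doob's maximal inequality for the submartingale `exp (S_t / s)`. -/
theorem measure_exists_sum_ge_le {Ω : Type*} {mΩ : MeasurableSpace Ω} {μ : Measure Ω}
    [IsProbabilityMeasure μ] {X : ℕ → Ω → ℝ} (hm : ∀ k, Measurable (X k)) (hi : iIndepFun X μ)
    {c : NNReal} (hX : ∀ k, HasSubgaussianMGF (X k) c μ) (h0 : ∀ k, ∫ ω, X k ω ∂μ = 0) (T : ℕ)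
    {s β : ℝ} (hs : 0 < s) (hc : T * c ≤ s ^ 2) (hβ : 0 < β) :
    μ {ω | ∃ t ≤ T, β * s ≤ ∑ k ∈ Finset.range t, X k ω} ≤
      ENNReal.ofReal (2 * Real.exp (-β)) := by
  rcases Nat.eq_zero_or_pos T with rfl | hT
  · have : {ω | ∃ t ≤ 0, β * s ≤ ∑ k ∈ Finset.range t, X k ω} = ∅ := by
      ext ω
      simpa using mul_pos hβ hs
    rw [this]; simp
  -- The natural filtration at time `t` knows `X 0, …, X t`, whence the shift by one.
  obtain ⟨N, rfl⟩ : ∃ N, T = N + 1 := ⟨T - 1, by omega⟩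
  set l : ℝ := s⁻¹ with hl
  have hlpos : 0 < l := inv_pos.2 hs
  set S : ℕ → Ω → ℝ := fun t ω => ∑ k ∈ Finset.range (t + 1), X k ω with hS
  set f : ℕ → Ω → ℝ := fun t ω => Real.exp (l * S t ω) with hf
  have hsm : ∀ k, StronglyMeasurable (X k) := fun k => (hm k).stronglyMeasurable
  set 𝒢 := Filtration.natural X hsm with h𝒢
  have hXad : ∀ k t, k ≤ t → Measurable[𝒢 t] (X k) := fun k t hkt =>
    ((Filtration.stronglyAdapted_natural hsm k).mono (𝒢.mono hkt)).measurable
  have hfad : ∀ t, StronglyMeasurable[𝒢 t] (f t) := by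
    intro t
    have : Measurable[𝒢 t] (S t) := by
      refine Finset.measurable_fun_sum _ fun k hk => hXad k t ?_
      have := Finset.mem_range.1 hk; omega
    exact (Real.measurable_exp.comp (this.const_mul l)).stronglyMeasurable
  have hSsub : ∀ t, HasSubgaussianMGF (S t) (∑ k ∈ Finset.range (t + 1), c) μ := fun t =>
    HasSubgaussianMGF.sum_of_iIndepFun hi (fun k _ => hX k)
  have hfint : ∀ t, Integrable (f t) μ := fun t => (hSsub t).integrable_exp_mul l
  have hsub : Submartingale f 𝒢 μ := by
    refine submartingale_nat hfad hfint fun t => ?_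
    have hfe : f (t + 1) = fun ω => f t ω * Real.exp (l * X (t + 1) ω) := by
      ext ω
      simp only [hf, hS]
      rw [Finset.sum_range_succ, mul_add, Real.exp_add]
    have hXi : Integrable (fun ω => Real.exp (l * X (t + 1) ω)) μ :=
      (hX _).integrable_exp_mul l
    have hpull := condExp_mul_of_stronglyMeasurable_left (μ := μ) (hfad t)
      (g := fun ω => Real.exp (l * X (t + 1) ω)) (by have := hfint (t + 1); rw [hfe] at this; exact this) hXi
    have hind : μ[fun ω => Real.exp (l * X (t + 1) ω) | 𝒢 t] =ᵐ[μ]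
        fun _ => ∫ ω, Real.exp (l * X (t + 1) ω) ∂μ := by
      refine condExp_indep_eq (m₁ := MeasurableSpace.comap (X (t + 1)) inferInstance)
        (hm _).comap_le (𝒢.le t) ?_ (hi.indep_comap_natural_of_lt hsm t.lt_succ_self)
      exact (Real.measurable_exp.comp ((comap_measurable _).const_mul l)).stronglyMeasurable
    have hone : 1 ≤ ∫ ω, Real.exp (l * X (t + 1) ω) ∂μ := by
      have h1 : ∫ ω, (l * X (t + 1) ω + 1) ∂μ ≤ ∫ ω, Real.exp (l * X (t + 1) ω) ∂μ :=
        integral_mono (((hX _).integrable.const_mul l).add (integrable_const 1)) hXi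
          fun ω => Real.add_one_le_exp _
      rw [integral_add ((hX _).integrable.const_mul l) (integrable_const 1),
        integral_const_mul, h0] at h1
      simpa using h1
    have : μ[f (t + 1) | 𝒢 t] =ᵐ[μ] f t * μ[fun ω => Real.exp (l * X (t + 1) ω) | 𝒢 t] := by
      rw [hfe]; exact hpull
    filter_upwards [this, hind] with ω h1 h2
    rw [h1, Pi.mul_apply, h2]
    exact le_mul_of_one_le_right (Real.exp_pos _).le hone
  have hmax := maximal_ineq hsub (fun t ω => (Real.exp_pos _).le)
    (ε := (Real.exp β).toNNReal) N
  set A := {ω | (((Real.exp β).toNNReal : NNReal) : ℝ) ≤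
    (Finset.range (N + 1)).sup' Finset.nonempty_range_add_one fun k => f k ω} with hA
  have hsubset : {ω | ∃ t ≤ N + 1, β * s ≤ ∑ k ∈ Finset.range t, X k ω} ⊆ A := by
    rintro ω ⟨t, ht, hle⟩
    have ht0 : t ≠ 0 := by
      rintro rfl
      have := mul_pos hβ hs
      simp at hle; linarith
    obtain ⟨r, rfl⟩ : ∃ r, t = r + 1 := ⟨t - 1, by omega⟩
    rw [hA, Set.mem_ofPred_eq, Real.coe_toNNReal _ (Real.exp_pos _).le]
    refine le_trans ?_ (Finset.le_sup' (fun k => f k ω) (Finset.mem_range.2 (by omega : r < N + 1)))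
    simp only [hf, hS]
    rw [Real.exp_le_exp, hl, inv_mul_eq_div, le_div_iff₀ hs]
    exact hle
  have hmgf : ∫ ω, f N ω ∂μ ≤ 2 := by
    have h1 := (hSsub N).mgf_le l
    have h2 : ((∑ k ∈ Finset.range (N + 1), c : NNReal) : ℝ) * l ^ 2 / 2 ≤ 1 / 2 := by
      have : ((∑ k ∈ Finset.range (N + 1), c : NNReal) : ℝ) ≤ s ^ 2 := by
        simpa using hc
      have h3 : s ^ 2 * l ^ 2 = 1 := by rw [hl]; field_simp
      nlinarith [sq_nonneg l]
    have h4 := exp_half_le_two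
    exact (h1.trans (Real.exp_le_exp.2 h2)).trans h4
  have hset : ∫ ω in A, f N ω ∂μ ≤ 2 :=
    (setIntegral_le_integral (hfint N) (Filter.Eventually.of_forall fun ω => (Real.exp_pos _).le)).trans hmgf
  have hfin : ENNReal.ofReal (Real.exp β) * μ A ≤ ENNReal.ofReal 2 :=
    hmax.trans (ENNReal.ofReal_le_ofReal hset)
  refine (measure_mono hsubset).trans ?_
  have : ENNReal.ofReal (2 * Real.exp (-β)) = ENNReal.ofReal 2 / ENNReal.ofReal (Real.exp β) := by
    rw [← ENNReal.ofReal_div_of_pos (Real.exp_pos _), Real.exp_neg]; rfl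
  rw [this, ENNReal.le_div_iff_mul_le (by left; simp [Real.exp_pos]) (by left; simp), mul_comm]
  exact hfin

theorem measure_exists_abs_sum_gt_le {Ω : Type*} {mΩ : MeasurableSpace Ω} {μ : Measure Ω}
    [IsProbabilityMeasure μ] {X : ℕ → Ω → ℝ} (hm : ∀ k, Measurable (X k)) (hi : iIndepFun X μ)
    {c : NNReal} (hX : ∀ k, HasSubgaussianMGF (X k) c μ) (h0 : ∀ k, ∫ ω, X k ω ∂μ = 0) (T : ℕ)
    {s β : ℝ} (hs : 0 < s) (hc : T * c ≤ s ^ 2) (hβ : 0 < β) :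
    μ {ω | ∃ t ≤ T, β * s < |∑ k ∈ Finset.range t, X k ω|} ≤
      ENNReal.ofReal (4 * Real.exp (-β)) := by
  have a1 := measure_exists_sum_ge_le hm hi hX h0 T hs hc hβ
  have a2 := measure_exists_sum_ge_le (X := fun k ω => -X k ω) (fun k => (hm k).neg)
    (hi.comp (fun _ x => -x) fun _ => measurable_neg) (fun k => (hX k).neg)
    (fun k => by rw [integral_neg, h0, neg_zero]) T hs hc hβ
  have hsub : {ω | ∃ t ≤ T, β * s < |∑ k ∈ Finset.range t, X k ω|} ⊆
      {ω | ∃ t ≤ T, β * s ≤ ∑ k ∈ Finset.range t, X k ω} ∪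
      {ω | ∃ t ≤ T, β * s ≤ ∑ k ∈ Finset.range t, -X k ω} := by
    rintro ω ⟨t, ht, h⟩
    rcases lt_abs.1 h with h | h
    · exact Or.inl ⟨t, ht, h.le⟩
    · refine Or.inr ⟨t, ht, ?_⟩
      rw [Finset.sum_neg_distrib]; exact h.le
  refine (measure_mono hsub).trans ((measure_union_le _ _).trans ((add_le_add a1 a2).trans ?_))
  rw [← ENNReal.ofReal_add (by positivity) (by positivity)]
  exact ENNReal.ofReal_le_ofReal (by linarith)

/-! ### Activation and logistic loss -/

theorem act_nonneg (q z : ℝ) : 0 ≤ act q z := Real.rpow_nonneg (le_max_left _ _) _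

theorem act_le_abs_rpow {q : ℝ} (hq : 0 ≤ q) (z : ℝ) : act q z ≤ |z| ^ q :=
  Real.rpow_le_rpow (le_max_left _ _) (max_le (abs_nonneg _) (le_abs_self _)) hq

/-- At the kink the derivative exists because it does off the kink and extends continuously. -/
theorem hasDerivAt_act {q : ℝ} (hq : 1 < q) (z : ℝ) :
    HasDerivAt (act q) (q * max 0 z ^ (q - 1)) z := by
  have hmax : Continuous fun z : ℝ => max 0 z := by fun_prop
  have hne : ∀ y : ℝ, y ≠ 0 → HasDerivAt (act q) (q * max 0 y ^ (q - 1)) y := by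
    intro y hy
    rcases lt_or_gt_of_ne hy with h | h
    · have e : (fun _ => (0 : ℝ)) =ᶠ[nhds y] act q := by
        filter_upwards [Iio_mem_nhds h] with x hx
        rw [act, max_eq_left (le_of_lt hx), Real.zero_rpow (by linarith)]
      rw [max_eq_left h.le, Real.zero_rpow (by linarith), mul_zero]
      exact (hasDerivAt_const y (0 : ℝ)).congr_of_eventuallyEq e.symm
    · have e : (fun x : ℝ => x ^ q) =ᶠ[nhds y] act q := by
        filter_upwards [Ioi_mem_nhds h] with x hx
        rw [act, max_eq_right (le_of_lt hx)]
      rw [max_eq_right h.le]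
      exact (Real.hasDerivAt_rpow_const (Or.inl hy)).congr_of_eventuallyEq e.symm
  by_cases hz : z = 0
  · subst hz
    refine hasDerivAt_of_hasDerivAt_of_ne (g := fun y => q * max 0 y ^ (q - 1)) hne ?_ ?_
    · exact (hmax.rpow_const fun _ => Or.inr (by linarith)).continuousAt
    · exact ((hmax.rpow_const fun _ => Or.inr (by linarith)).const_mul q |>.continuousAt)
  · exact hne z hz

theorem logistic_nonneg (z : ℝ) : 0 ≤ logistic z :=
  Real.log_nonneg (by have := Real.exp_pos (-z); linarith)

theorem logistic_antitone : Antitone logistic := fun a b h => by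
  have := Real.exp_pos (-b)
  exact Real.log_le_log (by linarith) (by gcongr)

theorem hasDerivAt_logistic (z : ℝ) :
    HasDerivAt logistic (-(Real.exp (-z) / (1 + Real.exp (-z)))) z := by
  have h : 1 + Real.exp (-z) ≠ 0 := by have := Real.exp_pos (-z); linarith
  refine ((((hasDerivAt_neg z).exp).const_add 1).log h).congr_deriv ?_
  ring

/-- Bernoulli's inequality `1 + s x ≤ (1 + x) ^ s` with exponent `exp s`: shifting the margin by a
constant changes the logistic loss by a constant factor. -/
theorem logistic_sub_le_exp_mul {z s : ℝ} (hs : 0 ≤ s) :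
    logistic (z - s) ≤ Real.exp s * logistic z := by
  have hx := Real.exp_pos (-z)
  have h1 : 1 ≤ Real.exp s := Real.one_le_exp hs
  unfold logistic
  rw [← Real.log_rpow (by linarith)]
  refine Real.log_le_log (by have := Real.exp_pos (-(z - s)); linarith) ?_
  have := one_add_mul_self_le_rpow_one_add (by linarith : -1 ≤ Real.exp (-z)) h1
  rwa [← Real.exp_add, show s + -z = -(z - s) by ring] at this

theorem logistic_sub_le_add {z s : ℝ} (hs : 0 ≤ s) : logistic (z - s) ≤ logistic z + s := by
  have hx := Real.exp_pos (-z)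
  have h1 : 1 ≤ Real.exp s := Real.one_le_exp hs
  unfold logistic
  rw [← Real.log_exp s, ← Real.log_mul (by linarith) (Real.exp_pos _).ne', Real.log_exp]
  refine Real.log_le_log (by have := Real.exp_pos (-(z - s)); linarith) ?_
  rw [show -(z - s) = -z + s by ring, Real.exp_add]
  nlinarith

/-! ### The network as a sum over patches -/

theorem sgn_mul_self (b : Bool) : sgn b * sgn b = 1 := by cases b <;> simp [sgn]

theorem abs_sgn (b : Bool) : |sgn b| = 1 := by cases b <;> simp [sgn]

/-- The signed response of the network to a single patch. -/
noncomputable def patchNet {d m : ℕ} (q : ℝ) (W : Weights d m) (x : Vec d) : ℝ :=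
  (1 / (m : ℝ)) * ∑ a, sgn a.1 * act q (inner ℝ (W a) x)

theorem net_eq_patchNet {d m : ℕ} (q : ℝ) (W : Weights d m) (x : Vec d × Vec d) :
    net q W x = patchNet q W x.1 + patchNet q W x.2 := by
  simp only [net, netF, patchNet, Fintype.sum_prod_type, Fintype.sum_bool, sgn,
    Finset.sum_add_distrib, if_true, Bool.false_eq_true, if_false, one_mul, neg_mul,
    Finset.sum_neg_distrib]
  ring

theorem abs_patchNet_le {d m : ℕ} (q : ℝ) (W : Weights d m) (x : Vec d) :
    |patchNet q W x| ≤ (1 / (m : ℝ)) * ∑ a, act q (inner ℝ (W a) x) := by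
  rw [patchNet, abs_mul, abs_of_nonneg (by positivity : (0 : ℝ) ≤ 1 / m)]
  refine mul_le_mul_of_nonneg_left ?_ (by positivity)
  refine (Finset.abs_sum_le_sum_abs _ _).trans (Finset.sum_le_sum fun a _ => ?_)
  rw [abs_mul, abs_sgn, one_mul, abs_of_nonneg (act_nonneg _ _)]

/-! ### The gradient of the training loss -/

theorem hasFDerivAt_act_inner {d : ℕ} {q : ℝ} (hq : 1 < q) (w x : Vec d) :
    HasFDerivAt (fun u : Vec d => act q (inner ℝ u x))
      ((q * max 0 (inner ℝ w x) ^ (q - 1)) • innerSL ℝ x) w := by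
  have h1 : HasFDerivAt (fun u : Vec d => inner ℝ u x) (innerSL ℝ x) w := by
    have := (innerSL ℝ x).hasFDerivAt (x := w)
    refine this.congr_of_eventuallyEq (Filter.Eventually.of_forall fun u => ?_)
    exact (real_inner_comm _ _)
  exact (hasDerivAt_act hq _).comp_hasFDerivAt w h1

theorem hasFDerivAt_patchNet_update {d m : ℕ} {q : ℝ} (hq : 1 < q) (W : Weights d m)
    (a : Bool × Fin m) (x : Vec d) :
    HasFDerivAt (fun u : Vec d => patchNet q (Function.update W a u) x)
      ((1 / (m : ℝ) * sgn a.1 * (q * max 0 (inner ℝ (W a) x) ^ (q - 1))) • innerSL ℝ x)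
      (W a) := by
  have h : ∀ b ∈ Finset.univ, HasFDerivAt
      (fun u : Vec d => sgn b.1 * act q (inner ℝ (Function.update W a u b) x))
      (if b = a then (sgn a.1 * (q * max 0 (inner ℝ (W a) x) ^ (q - 1))) • innerSL ℝ x else 0)
      (W a) := by
    intro b _
    by_cases hb : b = a
    · subst hb
      simp only [Function.update_self, if_true]
      rw [mul_smul]
      exact (hasFDerivAt_act_inner hq (W b) x).const_mul _
    · simp only [Function.update_of_ne hb, if_neg hb]
      exact hasFDerivAt_const _ _
  have := (HasFDerivAt.fun_sum h).const_mul (1 / (m : ℝ))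
  rw [Finset.sum_ite_eq' Finset.univ a, if_pos (Finset.mem_univ a), smul_smul, ← mul_assoc] at this
  exact this

/-- Each partial gradient is a combination of the training patches; the coefficient of a patch
`ξ_i` is at most `q |⟨w, ξ_i⟩|^(q-1) / (n m)`, because the logistic loss is `1`-Lipschitz. -/
theorem exists_gradFilter_eq {d n m : ℕ} {q : ℝ} (hq : 1 < q) (D : Fin n → Datum d)
    (W : Weights d m) (a : Bool × Fin m) :
    ∃ b c : Fin n → ℝ, gradFilter q D W a = ∑ i, (b i • (D i).1.1 + c i • (D i).1.2) ∧
      ∀ i, |c i| ≤ 1 / (n : ℝ) * (1 / (m : ℝ) * (q * |inner ℝ (W a) (D i).1.2| ^ (q - 1))) := by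
  set l : Fin n → ℝ := fun i => -(Real.exp (-margin q W (D i)) / (1 + Real.exp (-margin q W (D i))))
    with hl
  set k : Vec d → ℝ := fun x => 1 / (m : ℝ) * sgn a.1 * (q * max 0 (inner ℝ (W a) x) ^ (q - 1))
    with hk
  refine ⟨fun i => 1 / (n : ℝ) * (l i * (sgn (D i).2 * k (D i).1.1)),
    fun i => 1 / (n : ℝ) * (l i * (sgn (D i).2 * k (D i).1.2)), ?_, fun i => ?_⟩
  · have hi : ∀ i ∈ Finset.univ, HasFDerivAt
        (fun u : Vec d => logistic (margin q (Function.update W a u) (D i)))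
        (l i • (sgn (D i).2 • (k (D i).1.1 • innerSL ℝ (D i).1.1 +
          k (D i).1.2 • innerSL ℝ (D i).1.2))) (W a) := by
      intro i _
      have h1 := ((hasFDerivAt_patchNet_update hq W a (D i).1.1).add
        (hasFDerivAt_patchNet_update hq W a (D i).1.2)).const_mul (sgn (D i).2)
      have h2 : HasFDerivAt (fun u : Vec d => margin q (Function.update W a u) (D i))
        (sgn (D i).2 • (k (D i).1.1 • innerSL ℝ (D i).1.1 +
          k (D i).1.2 • innerSL ℝ (D i).1.2)) (W a) := by
        refine h1.congr_of_eventuallyEq (Filter.Eventually.of_forall fun u => ?_)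
        simp only [margin, net_eq_patchNet, Pi.add_apply]
      have h3 : HasDerivAt logistic (l i) (margin q (Function.update W a (W a)) (D i)) := by
        rw [Function.update_eq_self]
        exact hasDerivAt_logistic _
      exact HasDerivAt.comp_hasFDerivAt (h₂ := logistic) (W a) h3 h2
    have hs := (HasFDerivAt.fun_sum hi).const_mul (1 / (n : ℝ))
    refine HasGradientAt.gradient ?_
    rw [hasGradientAt_iff_hasFDerivAt]
    refine HasFDerivAt.congr_fderiv (f := fun u => trainLoss q D (Function.update W a u)) hs ?_
    rw [map_sum, Finset.smul_sum]
    refine Finset.sum_congr rfl fun i _ => ?_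
    rw [map_add, map_smulₛₗ, map_smulₛₗ]
    simp only [smul_add, smul_smul]
    rfl
  · have h1 : |l i| ≤ 1 := by
      have := Real.exp_pos (-margin q W (D i))
      rw [hl, abs_neg, abs_of_nonneg (by positivity), div_le_one (by positivity)]
      linarith
    have hp : max 0 (inner ℝ (W a) (D i).1.2) ^ (q - 1) ≤ |inner ℝ (W a) (D i).1.2| ^ (q - 1) :=
      act_le_abs_rpow (by linarith) _
    have h0 : 0 ≤ max 0 (inner ℝ (W a) (D i).1.2) ^ (q - 1) := act_nonneg _ _
    have h2 : |k (D i).1.2| = 1 / (m : ℝ) * (q * max 0 (inner ℝ (W a) (D i).1.2) ^ (q - 1)) := by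
      rw [hk]
      simp only [abs_mul, abs_sgn, mul_one]
      rw [abs_of_nonneg h0, abs_of_nonneg (by positivity : (0 : ℝ) ≤ 1 / m),
        abs_of_nonneg (by linarith : 0 ≤ q)]
    rw [abs_mul, abs_mul, abs_mul, abs_sgn, one_mul, abs_of_nonneg (by positivity : (0:ℝ) ≤ 1 / n), h2]
    have h3 : 1 / (m : ℝ) * (q * max 0 (inner ℝ (W a) (D i).1.2) ^ (q - 1)) ≤
        1 / (m : ℝ) * (q * |inner ℝ (W a) (D i).1.2| ^ (q - 1)) := by gcongr
    refine mul_le_mul_of_nonneg_left (le_trans ?_ h3) (by positivity)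
    exact mul_le_of_le_one_left (by positivity) h1

/-! ### Trajectory of noisy gradient descent -/

theorem abs_inner_sum_smul_le {d n : ℕ} (c : Fin n → ℝ) (x : Fin n → Vec d) (y : Vec d) {R r : ℝ}
    (hx : ∀ i, ‖x i‖ ≤ R) (hy : ‖y‖ ≤ r) :
    |inner ℝ (∑ i, c i • x i) y| ≤ (∑ i, |c i|) * (R * r) := by
  rw [sum_inner, Finset.sum_mul]
  refine (Finset.abs_sum_le_sum_abs _ _).trans (Finset.sum_le_sum fun i _ => ?_)
  rw [real_inner_smul_left, abs_mul]
  refine mul_le_mul_of_nonneg_left ?_ (abs_nonneg _)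
  exact (abs_real_inner_le_norm _ _).trans
    (mul_le_mul (hx i) hy (norm_nonneg _) ((norm_nonneg _).trans (hx i)))

theorem norm_sum_smul_le {d n : ℕ} (c : Fin n → ℝ) (x : Fin n → Vec d) {R : ℝ}
    (hx : ∀ i, ‖x i‖ ≤ R) : ‖∑ i, c i • x i‖ ≤ (∑ i, |c i|) * R := by
  rw [Finset.sum_mul]
  refine (norm_sum_le _ _).trans (Finset.sum_le_sum fun i _ => ?_)
  rw [norm_smul, Real.norm_eq_abs]
  exact mul_le_mul_of_nonneg_left (hx i) (abs_nonneg _)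

/-- As long as the budget `T η` is small, the gradient steps at most double the correlation of a
filter with the training noise: the coefficients on the `ξ_i` stay small because
`|⟨w, ξ_i⟩|^(q-1)` does. -/
theorem noisyGD_decomposition {d n m T : ℕ} {q η R ρ : ℝ} (hq : 1 < q) (hη : 0 < η)
    {D : Fin n → Datum d} {v : Vec d} (hD : ∀ i, (D i).1.1 = sgn (D i).2 • v)
    (hv : ∀ i, inner ℝ v (D i).1.2 = 0) (hR : ∀ i, ‖(D i).1.2‖ ≤ R) (hρ : 0 ≤ ρ)
    {W₀ : Weights d m} {z : ℕ → Weights d m}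
    (h0 : ∀ t ≤ T, ∀ a i, |inner ℝ (W₀ a - η • ∑ s ∈ Finset.range t, z s a) (D i).1.2| ≤ ρ)
    (hstep : T * (η * (1 / (m : ℝ) * (q * (2 * ρ) ^ (q - 1)))) * (R * R) ≤ ρ) :
    ∀ t ≤ T, ∀ a,
      (∃ (α : ℝ) (c : Fin n → ℝ), noisyGD q η D W₀ z t a =
        W₀ a - η • ∑ s ∈ Finset.range t, z s a + α • v + ∑ i, c i • (D i).1.2 ∧
        ∑ i, |c i| ≤ t * (η * (1 / (m : ℝ) * (q * (2 * ρ) ^ (q - 1))))) ∧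
      ∀ i, |inner ℝ (noisyGD q η D W₀ z t a) (D i).1.2| ≤ 2 * ρ := by
  set g : ℝ := η * (1 / (m : ℝ) * (q * (2 * ρ) ^ (q - 1))) with hg
  have hg0 : 0 ≤ g := by positivity
  have key : ∀ t ≤ T, ∀ a (α : ℝ) (c : Fin n → ℝ), noisyGD q η D W₀ z t a =
        W₀ a - η • ∑ s ∈ Finset.range t, z s a + α • v + ∑ i, c i • (D i).1.2 →
        ∑ i, |c i| ≤ t * g → ∀ i, |inner ℝ (noisyGD q η D W₀ z t a) (D i).1.2| ≤ 2 * ρ := by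
    intro t ht a α c hw hc i
    rw [hw, inner_add_left, inner_add_left, real_inner_smul_left, hv, mul_zero, add_zero]
    have h1 := abs_inner_sum_smul_le c (fun i => (D i).1.2) (D i).1.2 hR (hR i)
    have hR0 : 0 ≤ R := (norm_nonneg _).trans (hR i)
    have h2 : (∑ i, |c i|) * (R * R) ≤ T * g * (R * R) := by
      have : (t : ℝ) ≤ T := by exact_mod_cast ht
      gcongr
      exact hc.trans (by gcongr)
    calc _ ≤ _ := abs_add_le _ _
      _ ≤ ρ + ρ := add_le_add (h0 t ht a i) (h1.trans (h2.trans hstep))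
      _ = 2 * ρ := by ring
  intro t
  induction t with
  | zero =>
    intro ht a
    have e : noisyGD q η D W₀ z 0 a = W₀ a - η • ∑ s ∈ Finset.range 0, z s a + (0 : ℝ) • v +
        ∑ i, (0 : Fin n → ℝ) i • (D i).1.2 := by simp [noisyGD]
    exact ⟨⟨0, 0, e, by simp⟩, key 0 ht a 0 0 e (by simp)⟩
  | succ t ih =>
    intro ht a
    obtain ⟨⟨α, c, hw, hc⟩, hb⟩ := ih (by omega) a
    obtain ⟨b, c', hgrad, hc'⟩ := exists_gradFilter_eq hq D (noisyGD q η D W₀ z t) a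
    have e : noisyGD q η D W₀ z (t + 1) a =
        W₀ a - η • ∑ s ∈ Finset.range (t + 1), z s a +
          (α - η * ∑ i, b i * sgn (D i).2) • v + ∑ i, (c i - η * c' i) • (D i).1.2 := by
      change noisyGD q η D W₀ z t a - η • (gradFilter q D (noisyGD q η D W₀ z t) a + z t a) = _
      have e1 : ∑ i, (b i • (D i).1.1 + c' i • (D i).1.2) =
          (∑ i, b i * sgn (D i).2) • v + ∑ i, c' i • (D i).1.2 := by
        simp only [Finset.sum_add_distrib, hD, smul_smul, Finset.sum_smul]
      have e2 : ∑ i, (c i - η * c' i) • (D i).1.2 =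
          ∑ i, c i • (D i).1.2 - η • ∑ i, c' i • (D i).1.2 := by
        simp only [sub_smul, Finset.sum_sub_distrib, Finset.smul_sum, smul_smul]
      rw [hgrad, hw, e1, e2, Finset.sum_range_succ]
      module
    have hcn : ∑ i, |c i - η * c' i| ≤ ((t + 1 : ℕ) : ℝ) * g := by
      have h1 : ∀ i, |c i - η * c' i| ≤ |c i| + 1 / (n : ℝ) * g := by
        intro i
        refine (abs_sub _ _).trans (by
          gcongr
          rw [abs_mul, abs_of_pos hη, hg, mul_left_comm]
          refine mul_le_mul_of_nonneg_left ((hc' i).trans ?_) hη.le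
          gcongr
          exact hb i)
      refine (Finset.sum_le_sum fun i _ => h1 i).trans ?_
      rw [Finset.sum_add_distrib, Finset.sum_const, Finset.card_univ, Fintype.card_fin,
        nsmul_eq_mul, ← mul_assoc]
      have : (n : ℝ) * (1 / n) ≤ 1 := by
        rw [mul_one_div]; exact div_self_le_one _
      push_cast
      nlinarith
    exact ⟨⟨_, _, e, hcn⟩, key (t + 1) ht a _ _ e hcn⟩

/-! ### From training loss to test loss -/

/-- The excess of `g ^ q` over `1` is dominated by an exponential that is of order `exp (-X)` as soon
as `g` has fluctuations of order `1 / X`. No exponential moment of `g ^ q` itself is available,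
since `q > 2`. -/
theorem rpow_sub_one_le_exp {q X g : ℝ} (hq : 0 < q) (hX : 0 ≤ X) (hg : 0 ≤ g) :
    g ^ q - 1 ≤ q ^ q * Real.exp ((X + 1) * g - X) := by
  have hqq : 0 < q ^ q := Real.rpow_pos_of_pos hq q
  rcases le_total g 1 with h | h
  · have := Real.rpow_le_one hg h hq.le
    have := mul_pos hqq (Real.exp_pos ((X + 1) * g - X))
    linarith
  · have h1 : g ^ q ≤ q ^ q * Real.exp g := by
      have h2 : g / q ≤ Real.exp (g / q) := by
        have := Real.add_one_le_exp (g / q); linarith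
      have h3 := Real.rpow_le_rpow (by positivity) h2 hq.le
      rwa [Real.div_rpow hg hq.le, ← Real.exp_mul, div_mul_cancel₀ _ hq.ne',
        div_le_iff₀ hqq, mul_comm] at h3
    have h4 : Real.exp g ≤ Real.exp ((X + 1) * g - X) := by
      rw [Real.exp_le_exp]; nlinarith
    nlinarith

theorem integral_exp_abs_le {Ω : Type*} {mΩ : MeasurableSpace Ω} {μ : Measure Ω} {Y : Ω → ℝ}
    {c : NNReal} (h : HasSubgaussianMGF Y c μ) {l : ℝ} (hc : c * l ^ 2 ≤ 1) :
    Integrable (fun ω => Real.exp (l * |Y ω|)) μ ∧ ∫ ω, Real.exp (l * |Y ω|) ∂μ ≤ 4 := by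
  have i1 := h.integrable_exp_mul l
  have i2 := h.integrable_exp_mul (-l)
  have hb : ∀ ω, Real.exp (l * |Y ω|) ≤ Real.exp (l * Y ω) + Real.exp (-l * Y ω) := fun ω => by
    rcases abs_cases (Y ω) with ⟨e, _⟩ | ⟨e, _⟩ <;> rw [e]
    · have := Real.exp_pos (-l * Y ω); linarith
    · have := Real.exp_pos (l * Y ω); rw [mul_neg, neg_mul]; linarith
  have hi : Integrable (fun ω => Real.exp (l * |Y ω|)) μ := by
    refine (i1.add i2).mono ?_ (Filter.Eventually.of_forall fun ω => ?_)
    · have := h.aemeasurable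
      fun_prop
    · rw [Real.norm_of_nonneg (Real.exp_pos _).le]
      exact (hb ω).trans (le_abs_self _)
  refine ⟨hi, (integral_mono hi (i1.add i2) hb).trans ?_⟩
  have h4 := exp_half_le_two
  have m1 := (h.mgf_le l).trans ((Real.exp_le_exp.2 (by linarith)).trans h4)
  have m2 := (h.mgf_le (-l)).trans ((Real.exp_le_exp.2 (by rw [neg_sq]; linarith)).trans h4)
  have : ∫ ω, (Real.exp (l * Y ω) + Real.exp (-l * Y ω)) ∂μ = mgf Y μ l + mgf Y μ (-l) :=
    integral_add i1 i2
  change ∫ ω, (Real.exp (l * Y ω) + Real.exp (-l * Y ω)) ∂μ ≤ 4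
  linarith

/-- The part of the margin of a datum with label `y` that comes from the signal patch `y v`. -/
noncomputable def signalMargin {d m : ℕ} (q : ℝ) (v : Vec d) (W : Weights d m) (y : Bool) : ℝ :=
  sgn y * patchNet q W (sgn y • v)

theorem abs_margin_sub_signalMargin_le {d m : ℕ} (q : ℝ) (v : Vec d) (W : Weights d m)
    {p : Datum d} (hp : p.1.1 = sgn p.2 • v) :
    |margin q W p - signalMargin q v W p.2| ≤
      (1 / (m : ℝ)) * ∑ a, act q (inner ℝ (W a) p.1.2) := by
  rw [margin, signalMargin, net_eq_patchNet, hp, mul_add, add_sub_cancel_left, abs_mul, abs_sgn,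
    one_mul]
  exact abs_patchNet_le _ _ _

/-- A balanced training set sees both signals, so the training loss controls the logistic loss of
both signal margins. -/
theorem logistic_signalMargin_le {d n m : ℕ} {q : ℝ} (hq : 0 < q) (hn : 0 < n)
    {D : Fin n → Datum d} {v : Vec d} (hD : ∀ i, (D i).1.1 = sgn (D i).2 • v) (W : Weights d m)
    (hbal : |∑ i, sgn (D i).2| ≤ n / 2) (hW : ∀ a i, |inner ℝ (W a) (D i).1.2| ≤ 1) (y : Bool) :
    logistic (signalMargin q v W y + 2) ≤ 4 * trainLoss q D W := by
  have hN : ∀ i, (1 / (m : ℝ)) * ∑ a, act q (inner ℝ (W a) (D i).1.2) ≤ 2 := by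
    intro i
    have : ∑ a : Bool × Fin m, act q (inner ℝ (W a) (D i).1.2) ≤ ∑ a : Bool × Fin m, (1 : ℝ) :=
      Finset.sum_le_sum fun a _ => (act_le_abs_rpow hq.le _).trans
        (Real.rpow_le_one (abs_nonneg _) (hW a i) hq.le)
    rw [Finset.sum_const, Finset.card_univ, Fintype.card_prod, Fintype.card_bool, Fintype.card_fin,
      nsmul_eq_mul, mul_one] at this
    push_cast at this
    calc _ ≤ (1 / (m : ℝ)) * (2 * m) := mul_le_mul_of_nonneg_left this (by positivity)
      _ = 2 * (m / m) := by ring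
      _ ≤ 2 := by have := div_self_le_one (m : ℝ); linarith
  set l := logistic (signalMargin q v W y + 2) with hl
  have hl0 : 0 ≤ l := logistic_nonneg _
  have hterm : ∀ i, l * ((1 + sgn y * sgn (D i).2) / 2) ≤ logistic (margin q W (D i)) := by
    intro i
    -- The weight `(1 + y y_i) / 2` is the indicator of the class `y`.
    by_cases hy : (D i).2 = y
    · rw [hy, sgn_mul_self, show ((1 : ℝ) + 1) / 2 = 1 by norm_num, mul_one]
      refine logistic_antitone ?_
      have := (le_abs_self _).trans ((abs_margin_sub_signalMargin_le q v W (hD i)).trans (hN i))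
      rw [hy] at this
      linarith
    · have : sgn y * sgn (D i).2 = -1 := by
        revert hy
        cases y <;> cases (D i).2 <;> simp [sgn]
      rw [this]
      simpa using logistic_nonneg _
  have hsum : l * (n / 4) ≤ ∑ i, logistic (margin q W (D i)) := by
    refine le_trans ?_ (Finset.sum_le_sum fun i _ => hterm i)
    rw [← Finset.mul_sum, ← Finset.sum_div, Finset.sum_add_distrib, ← Finset.mul_sum]
    refine mul_le_mul_of_nonneg_left ?_ hl0
    have : |sgn y * ∑ i, sgn (D i).2| ≤ n / 2 := by rwa [abs_mul, abs_sgn, one_mul]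
    have := (abs_le.1 this).1
    simp
    linarith
  have hn' : (0 : ℝ) < n := by exact_mod_cast hn
  rw [trainLoss]
  calc l = 4 * (1 / n * (l * (n / 4))) := by field_simp
    _ ≤ _ := by gcongr

/-- The logistic loss of a test datum exceeds that of the training data only if the noise patch
moves the margin by more than `2`, which is exponentially unlikely. -/
theorem testRisk_le {d n m : ℕ} {q X σξ τ : ℝ} (hq : 0 < q) (hX : 0 ≤ X) (hn : 0 < n)
    {D : Fin n → Datum d} {v : Vec d} (hv : v ≠ 0) (hD : ∀ i, (D i).1.1 = sgn (D i).2 • v)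
    (W : Weights d m) (hbal : |∑ i, sgn (D i).2| ≤ n / 2)
    (hW : ∀ a i, |inner ℝ (W a) (D i).1.2| ≤ 1)
    (hperp : ∀ a, ∃ α : ℝ, (σξ * ‖W a - α • v‖) ^ 2 * (X + 1) ^ 2 ≤ 1)
    (hτ : trainLoss q D W ≤ τ) :
    testRisk q v σξ W ≤ ENNReal.ofReal (4 * Real.exp 4 * τ + 8 * q ^ q * Real.exp (-X)) := by
  have hqq : 0 < q ^ q := Real.rpow_pos_of_pos hq q
  set G : Vec d → ℝ := fun ξ => 4 * Real.exp 4 * τ +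
    (1 / (m : ℝ)) * ∑ a, q ^ q * Real.exp (-X) * Real.exp ((X + 1) * |inner ℝ (W a) ξ|) with hG
  have hpoint : ∀ p : Datum d, p.1.1 = sgn p.2 • v → logistic (margin q W p) ≤ G p.1.2 := by
    intro p hp
    set A := signalMargin q v W p.2 with hA
    set N := (1 / (m : ℝ)) * ∑ a, act q (inner ℝ (W a) p.1.2) with hN
    have h1 : A - N ≤ margin q W p := by
      have := (abs_le.1 (abs_margin_sub_signalMargin_le q v W hp)).1
      linarith
    have h2 : logistic (A - 2) ≤ 4 * Real.exp 4 * τ := by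
      have := logistic_sub_le_exp_mul (z := A + 2) (s := 4) (by norm_num)
      rw [show A + 2 - 4 = A - 2 by ring] at this
      have h3 := logistic_signalMargin_le hq hn hD W hbal hW p.2
      have := Real.exp_pos 4
      nlinarith
    have h3 : N - 2 ≤ (1 / (m : ℝ)) *
        ∑ a, q ^ q * Real.exp (-X) * Real.exp ((X + 1) * |inner ℝ (W a) p.1.2|) := by
      have h4 : ∑ a : Bool × Fin m, (act q (inner ℝ (W a) p.1.2) - 1) ≤
          ∑ a, q ^ q * Real.exp (-X) * Real.exp ((X + 1) * |inner ℝ (W a) p.1.2|) := by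
        refine Finset.sum_le_sum fun a _ => ?_
        rw [mul_assoc, ← Real.exp_add, neg_add_eq_sub]
        exact (sub_le_sub_right (act_le_abs_rpow hq.le _) 1).trans
          (rpow_sub_one_le_exp hq hX (abs_nonneg _))
      refine le_trans ?_ (mul_le_mul_of_nonneg_left h4 (by positivity))
      rw [Finset.sum_sub_distrib, mul_sub, Finset.sum_const, Finset.card_univ, Fintype.card_prod,
        Fintype.card_bool, Fintype.card_fin, nsmul_eq_mul, mul_one]
      have := div_self_le_one (m : ℝ)
      push_cast
      rw [one_div_mul_eq_div (m : ℝ) (2 * m), mul_div_assoc]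
      linarith
    have h5 : 0 ≤ (1 / (m : ℝ)) *
        ∑ a, q ^ q * Real.exp (-X) * Real.exp ((X + 1) * |inner ℝ (W a) p.1.2|) := by positivity
    set E := (1 / (m : ℝ)) *
        ∑ a, q ^ q * Real.exp (-X) * Real.exp ((X + 1) * |inner ℝ (W a) p.1.2|) with hE
    calc logistic (margin q W p) ≤ logistic (A - 2 - E) := logistic_antitone (by linarith)
      _ ≤ logistic (A - 2) + E := logistic_sub_le_add h5
      _ ≤ 4 * Real.exp 4 * τ + E := by linarith
  have hint : ∀ a, Integrable (fun ξ => Real.exp ((X + 1) * |inner ℝ (W a) ξ|)) (dataNoise v σξ) ∧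
      ∫ ξ, Real.exp ((X + 1) * |inner ℝ (W a) ξ|) ∂(dataNoise v σξ) ≤ 4 := by
    intro a
    obtain ⟨α, hα⟩ := hperp a
    have h1 := hasSubgaussianMGF_inner_dataNoise v (W a - α • v) σξ
      (c := ((σξ * ‖W a - α • v‖) ^ 2).toNNReal) (by
        rw [Real.coe_toNNReal _ (sq_nonneg _)]; exact (mul_pow _ _ _).ge)
    have h2 : HasSubgaussianMGF (fun ξ => inner ℝ (W a) ξ)
        ((σξ * ‖W a - α • v‖) ^ 2).toNNReal (dataNoise v σξ) := by
      refine h1.congr ?_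
      filter_upwards [ae_inner_dataNoise_eq_zero hv σξ] with ξ hξ
      rw [inner_sub_left, real_inner_smul_left, hξ, mul_zero, sub_zero]
    exact integral_exp_abs_le h2
      (by rwa [Real.coe_toNNReal _ (sq_nonneg _)])
  have hsumint : Integrable (fun ξ => (1 / (m : ℝ)) *
      ∑ a, q ^ q * Real.exp (-X) * Real.exp ((X + 1) * |inner ℝ (W a) ξ|)) (dataNoise v σξ) :=
    (integrable_finsetSum _ fun a _ => (hint a).1.const_mul _).const_mul _
  have hGint : Integrable G (dataNoise v σξ) := (integrable_const _).add hsumint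
  have hG0 : ∀ ξ, 0 ≤ G ξ := fun ξ =>
    (logistic_nonneg _).trans (hpoint ((sgn true • v, ξ), true) rfl)
  have hGval : ∫ ξ, G ξ ∂(dataNoise v σξ) ≤ 4 * Real.exp 4 * τ + 8 * q ^ q * Real.exp (-X) := by
    rw [hG, integral_add (integrable_const _) hsumint, integral_const, probReal_univ, one_smul,
      integral_const_mul, integral_finsetSum _ fun a _ => (hint a).1.const_mul _]
    have h1 : ∑ a : Bool × Fin m, ∫ ξ, q ^ q * Real.exp (-X) *
        Real.exp ((X + 1) * |inner ℝ (W a) ξ|) ∂(dataNoise v σξ) ≤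
        ∑ a : Bool × Fin m, q ^ q * Real.exp (-X) * 4 := by
      refine Finset.sum_le_sum fun a _ => ?_
      rw [integral_const_mul]
      exact mul_le_mul_of_nonneg_left (hint a).2 (by positivity)
    have h2 := mul_le_mul_of_nonneg_left h1 (by positivity : (0 : ℝ) ≤ 1 / m)
    rw [Finset.sum_const, Finset.card_univ, Fintype.card_prod, Fintype.card_bool,
      Fintype.card_fin, nsmul_eq_mul] at h2
    push_cast at h2
    have h3 : 1 / (m : ℝ) * (2 * m * (q ^ q * Real.exp (-X) * 4)) ≤ 8 * q ^ q * Real.exp (-X) := by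
      have := div_self_le_one (m : ℝ)
      have hp : 0 ≤ 8 * q ^ q * Real.exp (-X) := by positivity
      calc _ = (m / m : ℝ) * (8 * q ^ q * Real.exp (-X)) := by ring
        _ ≤ _ := mul_le_of_le_one_left hp this
    linarith
  calc testRisk q v σξ W
      ≤ ∫⁻ p, ENNReal.ofReal (logistic (margin q W ((sgn p.1 • v, p.2), p.1)))
          ∂(rademacher.prod (dataNoise v σξ)) := lintegral_map_le _ _
    _ ≤ ∫⁻ p, ENNReal.ofReal (G p.2) ∂(rademacher.prod (dataNoise v σξ)) :=
        lintegral_mono fun p => ENNReal.ofReal_le_ofReal (hpoint ((sgn p.1 • v, p.2), p.1) rfl)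
    _ = ∫⁻ ξ, ENNReal.ofReal (G ξ) ∂(dataNoise v σξ) := by
        refine (measurePreserving_snd (μ := rademacher) (ν := dataNoise v σξ)).lintegral_comp
          (f := fun ξ => ENNReal.ofReal (G ξ)) ?_
        simp only [hG]
        fun_prop
    _ = ENNReal.ofReal (∫ ξ, G ξ ∂(dataNoise v σξ)) :=
        (ofReal_integral_eq_lintegral_ofReal hGint (Filter.Eventually.of_forall hG0)).symm
    _ ≤ _ := ENNReal.ofReal_le_ofReal hGval

/-- Markov's inequality: a misclassified datum has logistic loss at least `log 2 > 1 / 2`. -/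
theorem testError_le_of_testRisk_le {d m : ℕ} {q σξ b : ℝ} {v : Vec d} {W : Weights d m}
    (hb : 0 ≤ b) (h : testRisk q v σξ W ≤ ENNReal.ofReal b) : testError q v σξ W ≤ 2 * b := by
  have h1 : ENNReal.ofReal (1 / 2) * (dataLaw v σξ) {p | margin q W p < 0} ≤
      ENNReal.ofReal b := by
    have hm := mul_meas_ge_le_lintegral₀ (μ := dataLaw v σξ)
      (f := fun p => ENNReal.ofReal (logistic (margin q W p))) ?_ (ENNReal.ofReal (1 / 2))
    · refine le_trans ?_ (hm.trans h)
      refine mul_le_mul_right (measure_mono fun p hp => ENNReal.ofReal_le_ofReal ?_) _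
      have h2 := logistic_antitone (le_of_lt (show margin q W p < 0 from hp))
      have h3 : logistic 0 = Real.log 2 := by norm_num [logistic]
      have := Real.log_two_gt_d9
      linarith
    · have hs : Measurable sgn := measurable_from_top
      have : Measurable fun p : Datum d => margin q W p := by
        unfold margin net netF act
        fun_prop
      unfold logistic
      fun_prop
  rw [testError, measureReal_def]
  have h2 := ENNReal.toReal_mono ENNReal.ofReal_ne_top h1
  rw [ENNReal.toReal_mul, ENNReal.toReal_ofReal (by norm_num), ENNReal.toReal_ofReal hb] at h2
  linarith

/-! ### The training run is typical with high probability -/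

theorem measure_preimage_le_of_measurePreserving {α β : Type*} {mα : MeasurableSpace α}
    {mβ : MeasurableSpace β} {μ : Measure α} {ν : Measure β} {f : α → β}
    (hf : MeasurePreserving f μ ν) (s : Set β) : μ (f ⁻¹' s) ≤ ν s := by
  rw [← hf.map_eq]
  exact Measure.le_map_apply hf.measurable.aemeasurable s

theorem measurable_sgn : Measurable sgn := measurable_from_top

theorem measurable_datum {d : ℕ} (v : Vec d) :
    Measurable fun p : Bool × Vec d => (((sgn p.1 • v, p.2), p.1) : Datum d) := by
  have h : Measurable fun b : Bool => sgn b • v := measurable_from_top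
  exact ((h.comp measurable_fst).prodMk measurable_snd).prodMk measurable_fst

theorem measurePreserving_noise {d : ℕ} (v : Vec d) (σξ : ℝ) :
    MeasurePreserving (fun p : Datum d => p.1.2) (dataLaw v σξ) (dataNoise v σξ) := by
  refine ⟨by fun_prop, ?_⟩
  rw [dataLaw, Measure.map_map (by fun_prop) (measurable_datum v)]
  exact measurePreserving_snd.map_eq

theorem measurePreserving_label {d : ℕ} (v : Vec d) (σξ : ℝ) :
    MeasurePreserving (fun p : Datum d => p.2) (dataLaw v σξ) rademacher := by
  refine ⟨by fun_prop, ?_⟩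
  rw [dataLaw, Measure.map_map (by fun_prop) (measurable_datum v)]
  exact measurePreserving_fst.map_eq

theorem ae_dataLaw {d : ℕ} {v : Vec d} (hv : v ≠ 0) (σξ : ℝ) :
    ∀ᵐ p ∂(dataLaw v σξ), p.1.1 = sgn p.2 • v ∧ inner ℝ v p.1.2 = 0 := by
  refine Filter.Eventually.and ?_ ?_
  · rw [dataLaw, ae_map_iff (measurable_datum v).aemeasurable]
    · exact Filter.Eventually.of_forall fun p => rfl
    · have : Measurable fun b : Bool => sgn b • v := measurable_from_top
      exact measurableSet_eq_fun (by fun_prop) (this.comp measurable_snd)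
  · exact (measurePreserving_noise v σξ).quasiMeasurePreserving.ae (ae_inner_dataNoise_eq_zero hv σξ)

theorem hasSubgaussianMGF_sgn {d : ℕ} (v : Vec d) (σξ : ℝ) :
    HasSubgaussianMGF (fun p : Datum d => sgn p.2) 1 (dataLaw v σξ) := by
  have h : HasSubgaussianMGF sgn 1 rademacher := by
    have h0 : ∫ b, sgn b ∂rademacher = 0 := by
      rw [rademacher, integral_add_measure (by simp [integrable_smul_measure])
        (by simp [integrable_smul_measure])]
      simp [integral_smul_measure, sgn]
    have := hasSubgaussianMGF_of_mem_Icc_of_integral_eq_zero (μ := rademacher) (a := -1) (b := 1)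
      measurable_sgn.aemeasurable
      (Filter.Eventually.of_forall fun b => by cases b <;> simp [sgn]) h0
    refine hasSubgaussianMGF_mono this ?_
    rw [← NNReal.coe_le_coe]
    norm_num
  rw [← (measurePreserving_label v σξ).map_eq] at h
  exact h.of_map (measurePreserving_label v σξ).measurable.aemeasurable

/-- The properties of the training set on which the analysis relies. -/
structure TypicalData {d n : ℕ} (v : Vec d) (R : ℝ) (D : Fin n → Datum d) : Prop where
  signal : ∀ i, (D i).1.1 = sgn (D i).2 • v
  perp : ∀ i, inner ℝ v (D i).1.2 = 0
  norm_le : ∀ i, ‖(D i).1.2‖ ≤ R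
  balanced : |∑ i, sgn (D i).2| ≤ n / 2

theorem norm_le_of_forall_abs_le {d : ℕ} {x : Vec d} {b : ℝ} (hb : 0 ≤ b) (h : ∀ k, |x k| ≤ b) :
    ‖x‖ ≤ b * √(d : ℝ) := by
  rw [EuclideanSpace.norm_eq, ← Real.sqrt_sq hb, ← Real.sqrt_mul (sq_nonneg b)]
  refine Real.sqrt_le_sqrt ?_
  have : ∑ k : Fin d, ‖x k‖ ^ 2 ≤ ∑ _k : Fin d, b ^ 2 := Finset.sum_le_sum fun k _ => by
    rw [Real.norm_eq_abs]
    exact pow_le_pow_left₀ (abs_nonneg _) (h k) 2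
  simpa [mul_comm] using this

theorem inner_single_one {d : ℕ} (k : Fin d) (x : Vec d) :
    inner ℝ (EuclideanSpace.single k (1 : ℝ)) x = x k := by
  simp [EuclideanSpace.inner_single_left]

theorem measure_not_typicalData_le {d n : ℕ} {v : Vec d} (hv : v ≠ 0) {σξ β : ℝ} (hσ : 0 < σξ)
    (hβ : 2 ≤ β) (hn : 4 * β ^ 2 ≤ n) :
    (Measure.pi fun _ : Fin n => dataLaw v σξ) {D | ¬ TypicalData v (β * noiseNorm d σξ) D} ≤
      (n * d + 1) * ENNReal.ofReal (4 * Real.exp (-β)) := by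
  set P := Measure.pi fun _ : Fin n => dataLaw v σξ with hP
  set e := ENNReal.ofReal (4 * Real.exp (-β)) with he
  have hev : ∀ i, MeasurePreserving (Function.eval i) P (dataLaw v σξ) := fun i =>
    measurePreserving_eval (fun _ : Fin n => dataLaw v σξ) i
  set A₀ : Set (Fin n → Datum d) :=
    {D | ¬ ∀ i, (D i).1.1 = sgn (D i).2 • v ∧ inner ℝ v (D i).1.2 = 0} with hA₀
  set A₁ : Fin n × Fin d → Set (Fin n → Datum d) := fun p => Function.eval p.1 ⁻¹'
    ((fun p : Datum d => p.1.2) ⁻¹'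
      {ξ | β * σξ < |inner ℝ (EuclideanSpace.single p.2 (1 : ℝ)) ξ|}) with hA₁
  set A₂ : Set (Fin n → Datum d) := {D | β * √(n : ℝ) < |∑ i, sgn (D i).2|} with hA₂
  have h0 : P A₀ = 0 := by
    have : ∀ᵐ D ∂P, ∀ i, (D i).1.1 = sgn (D i).2 • v ∧ inner ℝ v (D i).1.2 = 0 :=
      ae_all_iff.2 fun i => (hev i).quasiMeasurePreserving.ae (ae_dataLaw hv σξ)
    exact this
  have h1 : ∀ p, P (A₁ p) ≤ e := fun p => by
    refine (measure_preimage_le_of_measurePreserving (hev p.1) _).trans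
      ((measure_preimage_le_of_measurePreserving (measurePreserving_noise v σξ) _).trans ?_)
    exact measure_abs_gt_le (hasSubgaussianMGF_inner_dataNoise v _ σξ (c := (σξ ^ 2).toNNReal)
      (by simp)) hσ (by simp [sq_nonneg]) hβ
  have hn0 : (0 : ℝ) < n := lt_of_lt_of_le (by positivity) hn
  have h2 : P A₂ ≤ e := by
    have hsum : HasSubgaussianMGF (fun D : Fin n → Datum d => ∑ i, sgn (D i).2)
        (∑ i : Fin n, 1) P := by
      refine HasSubgaussianMGF.sum_of_iIndepFun (X := fun i (D : Fin n → Datum d) => sgn (D i).2)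
        (iIndepFun_pi (X := fun _ (p : Datum d) => sgn p.2) fun i =>
          (measurable_sgn.comp measurable_snd).aemeasurable) fun i _ => ?_
      have := hasSubgaussianMGF_sgn v σξ
      rw [← (hev i).map_eq] at this
      exact this.of_map (hev i).measurable.aemeasurable
    exact measure_abs_gt_le hsum (Real.sqrt_pos.2 hn0) (by rw [Real.sq_sqrt hn0.le]; simp) hβ
  have hsub : {D | ¬ TypicalData v (β * noiseNorm d σξ) D} ⊆ A₀ ∪ (⋃ p, A₁ p) ∪ A₂ := by
    intro D hD
    by_contra hc
    simp only [Set.mem_union, not_or, Set.mem_iUnion, not_exists] at hc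
    obtain ⟨⟨c0, c1⟩, c2⟩ := hc
    have c0' : ∀ i, (D i).1.1 = sgn (D i).2 • v ∧ inner ℝ v (D i).1.2 = 0 := not_not.1 c0
    refine hD ⟨fun i => (c0' i).1, fun i => (c0' i).2, fun i => ?_, ?_⟩
    · rw [noiseNorm, ← mul_assoc]
      refine norm_le_of_forall_abs_le (by positivity) fun k => ?_
      have : ¬ β * σξ < |inner ℝ (EuclideanSpace.single k (1 : ℝ)) (D i).1.2| := c1 (i, k)
      rwa [inner_single_one, not_lt] at this
    · refine (not_lt.1 c2).trans ?_
      have h3 : 2 * β ≤ √(n : ℝ) := Real.le_sqrt_of_sq_le (by linarith [mul_pow 2 β 2])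
      nlinarith [Real.mul_self_sqrt hn0.le, Real.sqrt_nonneg (n : ℝ)]
  refine (measure_mono hsub).trans ((measure_union_le _ _).trans ?_)
  rw [add_mul, one_mul]
  refine add_le_add ((measure_union_le _ _).trans ?_) h2
  rw [h0, zero_add]
  refine (measure_iUnion_fintype_le _ _).trans ((Finset.sum_le_sum fun p _ => h1 p).trans ?_)
  simp

/-- The law of the initialization and of the privacy noises. -/
noncomputable abbrev noiseLaw {d m : ℕ} (σ₀ : ℝ) (ν : Measure (Weights d m)) [IsProbabilityMeasure ν] :
    Measure (Weights d m × (ℕ → Weights d m)) :=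
  (Measure.pi fun _ : Bool × Fin m => isoGaussian d σ₀).prod (Measure.infinitePi fun _ : ℕ => ν)

/-- Along the direction `u`, of norm at most `r`, neither the initial filter nor any partial sum
of its privacy noises is large. -/
def TypicalAlong {d m : ℕ} (β σ₀ S : ℝ) (T : ℕ) (a : Bool × Fin m) (u : Vec d) (r : ℝ)
    (p : Weights d m × (ℕ → Weights d m)) : Prop :=
  |inner ℝ u (p.1 a)| ≤ β * (σ₀ * r) ∧
    ∀ t ≤ T, |∑ s ∈ Finset.range t, inner ℝ u (p.2 s a)| ≤ β * (S * r)

/-- The direction `u` is deterministic here; training noise vectors are treated by conditioning on the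
training set. -/
theorem measure_not_typicalAlong_le {d m : ℕ} {ν : Measure (Weights d m)} [IsProbabilityMeasure ν]
    {β σ₀ σz S r : ℝ} {T : ℕ} (hν : ∀ a, ν.map (fun z => z a) = isoGaussian d σz) (hβ : 2 ≤ β)
    (hσ₀ : 0 < σ₀) (hS : 0 < S) (hr : 0 < r) (hTS : T * σz ^ 2 ≤ S ^ 2) (a : Bool × Fin m)
    {u : Vec d} (hu : ‖u‖ ≤ r) :
    noiseLaw σ₀ ν {p | ¬ TypicalAlong β σ₀ S T a u r p} ≤
      2 * ENNReal.ofReal (4 * Real.exp (-β)) := by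
  have hur : ‖u‖ ^ 2 ≤ r ^ 2 := by gcongr
  have hsub : {p | ¬ TypicalAlong β σ₀ S T a u r p} ⊆
      Prod.fst ⁻¹' (Function.eval a ⁻¹' {w : Vec d | β * (σ₀ * r) < |inner ℝ u w|}) ∪
      Prod.snd ⁻¹' {z : ℕ → Weights d m |
        ∃ t ≤ T, β * (S * r) < |∑ s ∈ Finset.range t, inner ℝ u (z s a)|} := by
    intro p hp
    by_contra hc
    simp only [Set.mem_union, not_or, Set.mem_preimage] at hc
    refine hp ⟨not_lt.1 hc.1, fun t ht => ?_⟩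
    by_contra hlt
    exact hc.2 ⟨t, ht, not_le.1 hlt⟩
  have h1 : noiseLaw σ₀ ν (Prod.fst ⁻¹'
      (Function.eval a ⁻¹' {w : Vec d | β * (σ₀ * r) < |inner ℝ u w|})) ≤
      ENNReal.ofReal (4 * Real.exp (-β)) := by
    refine (measure_preimage_le_of_measurePreserving measurePreserving_fst _).trans
      ((measure_preimage_le_of_measurePreserving
        (measurePreserving_eval (fun _ : Bool × Fin m => isoGaussian d σ₀) a) _).trans ?_)
    refine measure_abs_gt_le (hasSubgaussianMGF_inner_isoGaussian u σ₀
      (c := ((σ₀ * r) ^ 2).toNNReal) ?_) (by positivity) ?_ hβ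
    · rw [Real.coe_toNNReal _ (sq_nonneg _), mul_pow]; gcongr
    · rw [Real.coe_toNNReal _ (sq_nonneg _)]
  have h2 : noiseLaw σ₀ ν (Prod.snd ⁻¹' {z : ℕ → Weights d m |
        ∃ t ≤ T, β * (S * r) < |∑ s ∈ Finset.range t, inner ℝ u (z s a)|}) ≤
      ENNReal.ofReal (4 * Real.exp (-β)) := by
    refine (measure_preimage_le_of_measurePreserving measurePreserving_snd _).trans ?_
    have hmp : ∀ k, MeasurePreserving (fun z : ℕ → Weights d m => z k a)
        (Measure.infinitePi fun _ : ℕ => ν) (isoGaussian d σz) := fun k =>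
      (⟨by fun_prop, hν a⟩ : MeasurePreserving (fun z : Weights d m => z a) ν _).comp
        (measurePreserving_eval_infinitePi (fun _ : ℕ => ν) k)
    refine measure_exists_abs_sum_gt_le (X := fun k (z : ℕ → Weights d m) => inner ℝ u (z k a))
      (c := ((σz * r) ^ 2).toNNReal) (fun k => by fun_prop)
      (iIndepFun_infinitePi (X := fun _ (w : Weights d m) => inner ℝ u (w a)) fun _ => by fun_prop)
      (fun k => ?_) (fun k => ?_) T (by positivity) ?_ (by linarith)
    · have := hasSubgaussianMGF_inner_isoGaussian u σz (c := ((σz * r) ^ 2).toNNReal) (by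
        rw [Real.coe_toNNReal _ (sq_nonneg _), mul_pow]; gcongr)
      rw [← (hmp k).map_eq] at this
      exact this.of_map (hmp k).measurable.aemeasurable
    · rw [← integral_map (φ := fun z : ℕ → Weights d m => z k a) (f := fun w => inner ℝ u w)
        (hmp k).measurable.aemeasurable (by fun_prop), (hmp k).map_eq]
      exact integral_inner_multivariateGaussian u
    · rw [Real.coe_toNNReal _ (sq_nonneg _), mul_pow, mul_pow, ← mul_assoc]; gcongr
  refine (measure_mono hsub).trans ((measure_union_le _ _).trans ((add_le_add h1 h2).trans ?_))
  rw [two_mul]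

/-- A training run with typical data, whose initialization and accumulated privacy noises are
typical along every training noise vector and along every coordinate. -/
structure TypicalRun {d n m : ℕ} (v : Vec d) (β R σ₀ S : ℝ) (T : ℕ) (ω : Run d n m) : Prop where
  data : TypicalData v R ω.1
  along_noise : ∀ a i, TypicalAlong β σ₀ S T a (ω.1 i).1.2 R ω.2
  along_basis : ∀ a k, TypicalAlong β σ₀ S T a (EuclideanSpace.single k (1 : ℝ)) 1 ω.2

theorem measurableSet_typicalAlong {d m : ℕ} {α : Type*} [MeasurableSpace α] (β σ₀ S : ℝ) (T : ℕ)
    (a : Bool × Fin m) {u : α → Vec d} (hu : Measurable u) (r : ℝ) :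
    MeasurableSet {p : α × (Weights d m × (ℕ → Weights d m)) |
      TypicalAlong β σ₀ S T a (u p.1) r p.2} := by
  have : {p : α × (Weights d m × (ℕ → Weights d m)) | TypicalAlong β σ₀ S T a (u p.1) r p.2} =
      {p | |inner ℝ (u p.1) (p.2.1 a)| ≤ β * (σ₀ * r)} ∩ ⋂ t, ⋂ (_ : t ≤ T),
        {p | |∑ s ∈ Finset.range t, inner ℝ (u p.1) (p.2.2 s a)| ≤ β * (S * r)} := by
    ext p; simp [TypicalAlong]
  rw [this]
  exact (measurableSet_le (by fun_prop) (by fun_prop)).inter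
    (MeasurableSet.iInter fun t => MeasurableSet.iInter fun _ =>
      measurableSet_le (by fun_prop) (by fun_prop))

theorem runLaw_not_typicalRun_le {d n m : ℕ} {v : Vec d} (hv : v ≠ 0) {σξ β σ₀ σz S : ℝ} {T : ℕ}
    (hσ : 0 < σξ) (hd : 0 < d) (hβ : 2 ≤ β) (hn : 4 * β ^ 2 ≤ n)
    {ν : Measure (Weights d m)} [IsProbabilityMeasure ν]
    (hν : ∀ a, ν.map (fun z => z a) = isoGaussian d σz)
    (hσ₀ : 0 < σ₀) (hS : 0 < S) (hTS : T * σz ^ 2 ≤ S ^ 2) :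
    runLaw n v σξ σ₀ ν {ω | ¬ TypicalRun v β (β * noiseNorm d σξ) σ₀ S T ω} ≤
      (n * d + 1 + 4 * m * (n + d)) * ENNReal.ofReal (4 * Real.exp (-β)) := by
  set R := β * noiseNorm d σξ with hR
  have hR0 : 0 < R := by
    have : (0 : ℝ) < d := by exact_mod_cast hd
    rw [hR, noiseNorm]; positivity
  set e := ENNReal.ofReal (4 * Real.exp (-β)) with he
  set B₀ : Set (Run d n m) := Prod.fst ⁻¹' {D | ¬ TypicalData v R D} with hB₀
  set B₁ : (Bool × Fin m) × Fin n → Set (Run d n m) := fun j =>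
    {ω | ‖(ω.1 j.2).1.2‖ ≤ R} ∩ {ω | TypicalAlong β σ₀ S T j.1 (ω.1 j.2).1.2 R ω.2}ᶜ with hB₁
  set B₂ : (Bool × Fin m) × Fin d → Set (Run d n m) := fun j => Prod.snd ⁻¹'
    {p | ¬ TypicalAlong β σ₀ S T j.1 (EuclideanSpace.single j.2 (1 : ℝ)) 1 p} with hB₂
  have hsub : {ω : Run d n m | ¬ TypicalRun v β R σ₀ S T ω} ⊆
      B₀ ∪ ((⋃ j, B₁ j) ∪ ⋃ j, B₂ j) := by
    intro ω hω
    by_contra hc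
    simp only [Set.mem_union, not_or, Set.mem_iUnion, not_exists] at hc
    obtain ⟨c0, c1, c2⟩ := hc
    have c0' : TypicalData v R ω.1 := not_not.1 c0
    refine hω ⟨c0', fun a i => ?_, fun a k => not_not.1 (c2 (a, k))⟩
    by_contra hcc
    exact c1 (a, i) ⟨c0'.norm_le i, hcc⟩
  have h0 : runLaw n v σξ σ₀ ν B₀ ≤ (n * d + 1) * e :=
    (measure_preimage_le_of_measurePreserving measurePreserving_fst _).trans
      (measure_not_typicalData_le hv hσ hβ hn)
  have h1 : ∀ j, runLaw n v σξ σ₀ ν (B₁ j) ≤ 2 * e := by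
    intro j
    have hm : MeasurableSet (B₁ j) := by
      refine MeasurableSet.inter (measurableSet_le (by fun_prop) (by fun_prop)) ?_
      exact (measurableSet_typicalAlong β σ₀ S T j.1
        (u := fun D : Fin n → Datum d => (D j.2).1.2) (by fun_prop) R).compl
    rw [runLaw, Measure.prod_apply hm]
    calc _ ≤ ∫⁻ _D, 2 * e ∂(Measure.pi fun _ : Fin n => dataLaw v σξ) := by
          refine lintegral_mono fun D => ?_
          by_cases hD : ‖(D j.2).1.2‖ ≤ R
          · exact (measure_mono fun p hp => hp.2).trans
              (measure_not_typicalAlong_le hν hβ hσ₀ hS hR0 hTS j.1 hD)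
          · have : Prod.mk D ⁻¹' B₁ j = ∅ := by
              ext p
              simp only [Set.mem_preimage, Set.mem_empty_iff_false, iff_false]
              exact fun hp => hD hp.1
            rw [this]; simp
      _ = 2 * e := by simp
  have h2 : ∀ j, runLaw n v σξ σ₀ ν (B₂ j) ≤ 2 * e := fun j =>
    (measure_preimage_le_of_measurePreserving measurePreserving_snd _).trans
      (measure_not_typicalAlong_le hν hβ hσ₀ hS one_pos hTS j.1 (by simp))
  have h1' := (measure_iUnion_fintype_le (runLaw n v σξ σ₀ ν) B₁).trans
    (Finset.sum_le_sum fun j _ => h1 j)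
  have h2' := (measure_iUnion_fintype_le (runLaw n v σξ σ₀ ν) B₂).trans
    (Finset.sum_le_sum fun j _ => h2 j)
  refine (measure_mono hsub).trans ((measure_union_le _ _).trans
    ((add_le_add h0 ((measure_union_le _ _).trans (add_le_add h1' h2'))).trans (le_of_eq ?_)))
  simp only [Finset.sum_const, Finset.card_univ, Fintype.card_prod, Fintype.card_bool,
    Fintype.card_fin, nsmul_eq_mul]
  push_cast
  ring

/-! ### Iterates of a typical run -/

/-- Along a typical run every filter stays small in the noise directions: against the training noise
vectors and, up to a multiple of `v`, in norm. -/
theorem TypicalRun.iterate_bounds {d n m T : ℕ} {v : Vec d} {q η β Γ R σ₀ σξ ρ : ℝ} (hq : 1 < q)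
    (hη : 0 < η) (hβ : 1 ≤ β) (hΓ : 1 ≤ Γ) (hσ₀ : 0 < σ₀) (hσ : 0 < σξ) (hd : 0 < d)
    (hR : R = β * noiseNorm d σξ) (hρ : ρ = 2 * β * Γ * σ₀ * R) {ω : Run d n m}
    (hω : TypicalRun v β R σ₀ (Γ * σ₀ / η) T ω)
    (hstep : T * (η * (1 / (m : ℝ) * (q * (2 * ρ) ^ (q - 1)))) * (R * R) ≤ ρ) {t : ℕ} (ht : t ≤ T) :
    (∀ a i, |inner ℝ (iterate q η ω t a) (ω.1 i).1.2| ≤ 2 * ρ) ∧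
      ∀ a, ∃ α : ℝ, σξ * ‖iterate q η ω t a - α • v‖ ≤ 2 * ρ := by
  have hd1 : (1 : ℝ) ≤ √(d : ℝ) := Real.one_le_sqrt.2 (by exact_mod_cast hd)
  have hR0 : 0 < R := by rw [hR, noiseNorm]; positivity
  have hρ0 : 0 ≤ ρ := by rw [hρ]; positivity
  have along : ∀ (a : Bool × Fin m) (u : Vec d) (r : ℝ), 0 ≤ r →
      TypicalAlong β σ₀ (Γ * σ₀ / η) T a u r ω.2 → ∀ t ≤ T,
      |inner ℝ u (ω.2.1 a - η • ∑ s ∈ Finset.range t, ω.2.2 s a)| ≤ 2 * β * Γ * σ₀ * r := by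
    intro a u r hr h t ht
    rw [inner_sub_right, real_inner_smul_right, inner_sum]
    have h1 := h.1
    have h2 := mul_le_mul_of_nonneg_left (h.2 t ht) hη.le
    rw [show η * (β * (Γ * σ₀ / η * r)) = β * Γ * σ₀ * r by field_simp] at h2
    have h3 : β * (σ₀ * r) ≤ β * Γ * σ₀ * r := by
      have : 0 ≤ β * (σ₀ * r) := by positivity
      nlinarith
    refine (abs_sub _ _).trans ?_
    rw [abs_mul, abs_of_pos hη]
    linarith
  have hdec := noisyGD_decomposition (η := η) (W₀ := ω.2.1) (z := ω.2.2) hq hη hω.data.signal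
    hω.data.perp hω.data.norm_le hρ0 (fun t ht a i => by
      rw [real_inner_comm, hρ]
      exact along a _ R hR0.le (hω.along_noise a i) t ht) hstep t ht
  refine ⟨fun a i => (hdec a).2 i, fun a => ?_⟩
  obtain ⟨⟨α, c, hw, hc⟩, -⟩ := hdec a
  refine ⟨α, ?_⟩
  set g := η * (1 / (m : ℝ) * (q * (2 * ρ) ^ (q - 1))) with hg
  have hg0 : 0 ≤ g := by positivity
  have e : iterate q η ω t a - α • v =
      (ω.2.1 a - η • ∑ s ∈ Finset.range t, ω.2.2 s a) + ∑ i, c i • (ω.1 i).1.2 := by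
    rw [iterate, hw]; abel
  have h1 : ‖ω.2.1 a - η • ∑ s ∈ Finset.range t, ω.2.2 s a‖ ≤ 2 * β * Γ * σ₀ * √(d : ℝ) := by
    refine norm_le_of_forall_abs_le (by positivity) fun k => ?_
    have := along a _ 1 zero_le_one (hω.along_basis a k) t ht
    rwa [inner_single_one, mul_one] at this
  have h2 : ‖∑ i, c i • (ω.1 i).1.2‖ ≤ T * g * R := by
    refine (norm_sum_smul_le c _ hω.data.norm_le).trans ?_
    have : (t : ℝ) ≤ T := by exact_mod_cast ht
    gcongr
    exact hc.trans (by gcongr)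
  have hσR : σξ ≤ R := by
    rw [hR, noiseNorm]
    have : σξ ≤ σξ * √(d : ℝ) := le_mul_of_one_le_right hσ.le hd1
    nlinarith
  -- `hstep` carries a factor `R * R`; trading one `R` for `σξ ≤ R` only loses.
  have h3 : σξ * (T * g * R) ≤ ρ := by
    refine le_trans ?_ hstep
    have : 0 ≤ T * g * R := by positivity
    nlinarith
  have h4 : σξ * (2 * β * Γ * σ₀ * √(d : ℝ)) ≤ ρ := by
    rw [hρ, hR, noiseNorm]
    have : 0 ≤ 2 * β * Γ * σ₀ * (σξ * √(d : ℝ)) := by positivity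
    nlinarith
  calc σξ * ‖iterate q η ω t a - α • v‖
      ≤ σξ * (2 * β * Γ * σ₀ * √(d : ℝ) + T * g * R) := by
        rw [e]
        exact mul_le_mul_of_nonneg_left ((norm_add_le _ _).trans (add_le_add h1 h2)) hσ.le
    _ ≤ 2 * ρ := by rw [mul_add]; linarith

/-! ### Arithmetic of the parameters -/

theorem one_le_one_add_log {d : ℕ} (hd : 0 < d) : 1 ≤ 1 + Real.log d := by
  have := Real.log_nonneg (by exact_mod_cast hd : (1 : ℝ) ≤ d)
  linarith

theorem one_le_polylog {B : ℝ} (hB : 1 ≤ B) {d : ℕ} (hd : 0 < d) : 1 ≤ polylog B d :=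
  one_le_mul_of_one_le_of_one_le hB
    (Real.one_le_rpow (one_le_one_add_log hd) (by linarith))

theorem polylog_mono {B B' : ℝ} (hB : 0 ≤ B) (h : B ≤ B') {d : ℕ} (hd : 0 < d) :
    polylog B d ≤ polylog B' d := by
  have h1 := one_le_one_add_log hd
  have hB' : 0 ≤ B' := hB.trans h
  unfold polylog
  gcongr

/-- Polynomials in polylogarithmic factors are absorbed by a larger polylogarithmic factor. -/
theorem mul_polylog_pow_le (A : ℝ) {B : ℝ} (hB : 1 ≤ B) {d : ℕ} (hd : 0 < d) :
    A * (1 + Real.log d) ^ 2 * polylog B d ^ 4 ≤ polylog (max (A * B ^ 4) (4 * B + 2)) d := by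
  have h1 := one_le_one_add_log hd
  set L := 1 + Real.log d with hL
  set K := max (A * B ^ 4) (4 * B + 2) with hK
  have e : A * L ^ 2 * polylog B d ^ 4 = A * B ^ 4 * L ^ (4 * B + 2) := by
    rw [Real.rpow_add (by linarith), mul_comm 4 B, Real.rpow_mul (by linarith), polylog, ← hL,
      mul_pow]
    norm_cast
    ring
  rw [e, polylog, ← hL]
  have hK0 : 0 ≤ K := le_trans (by linarith) (le_max_right _ _)
  exact mul_le_mul (le_max_left _ _) (Real.rpow_le_rpow_of_exponent_le h1 (le_max_right _ _))
    (by positivity) hK0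

theorem sqrt_two_mul_log_le {δ P : ℝ} (hδ : 0 < δ) (hP : 1 ≤ P) (h : Real.log (1 / δ) ≤ P) :
    √(2 * Real.log (1.25 / δ)) ≤ 2 * P := by
  refine Real.sqrt_le_iff.2 ⟨by linarith, ?_⟩
  have h1 : Real.log (1.25 / δ) = Real.log 1.25 + Real.log (1 / δ) := by
    rw [← Real.log_mul (by norm_num) (by positivity)]; congr 1; ring
  have h2 := Real.log_le_sub_one_of_pos (by norm_num : (0 : ℝ) < 1.25)
  rw [h1]
  nlinarith

/-- The accumulated privacy noise over the budget is at most a polylogarithmic multiple of the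
initialization. -/
theorem mul_privacyStd_sq_le {d n m T : ℕ} {v : Vec d} {σξ ε δ Cs η σ₀ P : ℝ} (hn : 0 < n)
    (hm : 0 < m) (hG : 0 < ‖v‖ + noiseNorm d σξ) (hε : 0 < ε) (hη : 0 < η) (hσ₀ : 0 < σ₀)
    (hP : 1 ≤ P) (hCs : 0 < Cs) (hCsP : Cs ≤ P) (hδ : 0 < δ) (hδP : Real.log (1 / δ) ≤ P)
    (hT : T * η * (‖v‖ + noiseNorm d σξ) ≤ P * (m * n * ε * σ₀)) :
    T * privacyStd n m T v σξ ε δ Cs ^ 2 ≤ (4 * P ^ 3 * σ₀ / η) ^ 2 := by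
  have hn' : (0 : ℝ) < n := by exact_mod_cast hn
  have hm' : (0 : ℝ) < m := by exact_mod_cast hm
  have hs := sqrt_two_mul_log_le hδ hP hδP
  have e : T * privacyStd n m T v σξ ε δ Cs ^ 2 =
      (T * η * (‖v‖ + noiseNorm d σξ) / (m * n * ε) * (Cs * √(2 * Real.log (1.25 / δ))) / η) ^ 2 := by
    have : (T : ℝ) = √(T : ℝ) ^ 2 := (Real.sq_sqrt (Nat.cast_nonneg _)).symm
    rw [privacyStd]
    nth_rewrite 1 3 [this]
    field_simp
  rw [e]
  have h1 : T * η * (‖v‖ + noiseNorm d σξ) / (m * n * ε) ≤ P * σ₀ := by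
    rw [div_le_iff₀ (by positivity)]; linarith
  have h2 : Cs * √(2 * Real.log (1.25 / δ)) ≤ P * (2 * P) := by gcongr
  refine pow_le_pow_left₀ (by positivity) (div_le_div_of_nonneg_right ?_ hη.le) 2
  calc _ ≤ P * σ₀ * (P * (2 * P)) := by gcongr
    _ ≤ 4 * P ^ 3 * σ₀ := by
      have : 0 ≤ P ^ 3 * σ₀ := by positivity
      linarith

/-- The union bound involves at most `10 d ^ 2` events, each of probability at most
`4 exp (-10 (1 + log d))`. -/
theorem failure_probability_le {d n m : ℕ} (hd : 0 < d) (hn : n ≤ d) (hm : m ≤ d) :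
    (n * d + 1 + 4 * m * (n + d)) * (4 * Real.exp (-(10 * (1 + Real.log d)))) ≤ 1 / (d : ℝ) := by
  have hd' : (1 : ℝ) ≤ d := by exact_mod_cast hd
  have hn' : (n : ℝ) ≤ d := by exact_mod_cast hn
  have hm' : (m : ℝ) ≤ d := by exact_mod_cast hm
  have e1 : Real.exp (10 * (1 + Real.log d)) = Real.exp 1 ^ 10 * (d : ℝ) ^ 10 := by
    rw [← mul_pow, ← Real.exp_log (by linarith : (0 : ℝ) < d), ← Real.exp_add, Real.exp_log (by linarith),
      ← Real.exp_nat_mul]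
    norm_num
  have e2 : (2 : ℝ) ^ 10 ≤ Real.exp 1 ^ 10 :=
    pow_le_pow_left₀ (by norm_num) (by have := Real.exp_one_gt_d9; linarith) 10
  have h1 : (n * d + 1 + 4 * m * (n + d) : ℝ) ≤ 10 * d ^ 2 := by
    calc (n * d + 1 + 4 * m * (n + d) : ℝ) ≤ d * d + d * d + 4 * d * (d + d) := by
          gcongr; nlinarith
      _ = 10 * d ^ 2 := by ring
  rw [Real.exp_neg, e1, ← mul_assoc, ← div_eq_mul_inv, div_le_div_iff₀ (by positivity) (by linarith),
    one_mul]
  calc (n * d + 1 + 4 * m * (n + d) : ℝ) * 4 * d ≤ 10 * d ^ 2 * 4 * d := by gcongr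
    _ = 40 * d ^ 3 := by ring
    _ ≤ Real.exp 1 ^ 10 * d ^ 10 := by
      have : (d : ℝ) ^ 3 ≤ d ^ 10 := pow_le_pow_right₀ hd' (by norm_num)
      gcongr
      linarith

theorem SignalLearning.samples_le_dim {d n m : ℕ} {q Λ : ℝ} {v : Vec d} {σξ ε η σ₀ : ℝ}
    (h : SignalLearning q Λ n m v σξ ε η σ₀) (hΛ : 1 ≤ Λ) : n ≤ d ∧ m ≤ d := by
  have hn : 1 ≤ (n : ℝ) := hΛ.trans h.samples_ge
  have hm : 1 ≤ (m : ℝ) := hΛ.trans h.width_ge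
  have h1 : (m : ℝ) ≤ (m : ℝ) ^ max 2 (4 / (q - 2)) := by
    simpa using Real.rpow_le_rpow_of_exponent_le hm
      (show (1 : ℝ) ≤ max 2 (4 / (q - 2)) from le_max_of_le_left (by norm_num))
  have h2 : (n : ℝ) ≤ (n : ℝ) ^ max 4 ((2 * q - 2) / (q - 2)) := by
    simpa using Real.rpow_le_rpow_of_exponent_le hn
      (show (1 : ℝ) ≤ max 4 ((2 * q - 2) / (q - 2)) from le_max_of_le_left (by norm_num))
  have h3 : (m : ℝ) * n ≤ d := by
    refine le_trans ?_ h.dim_ge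
    gcongr
    exact h1.trans (le_mul_of_one_le_left (by positivity) hΛ)
  constructor
  · exact_mod_cast (show (n : ℝ) ≤ d by nlinarith)
  · exact_mod_cast (show (m : ℝ) ≤ d by nlinarith)

/-- The last upper bound on the initialization, in the form `Λ σ₀ ‖ξ‖ (n ε) ^ (1 + 1 / q) ≤ 1`. -/
theorem SignalLearning.init_mul_le {d n m : ℕ} {q Λ : ℝ} {v : Vec d} {σξ ε η σ₀ : ℝ}
    (h : SignalLearning q Λ n m v σξ ε η σ₀) (hq : 0 < q) (hΛ : 0 < Λ) (hn : 0 < n)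
    (hN : 0 < noiseNorm d σξ) :
    Λ * (σ₀ * noiseNorm d σξ * (n * ε) ^ (1 + 1 / q)) ≤ 1 := by
  have hy : 0 < (n : ℝ) * ε := mul_pos (by exact_mod_cast hn) h.privacy_pos
  have h1 := h.init_le.trans (mul_le_mul_of_nonneg_left
    ((min_le_right _ _).trans (min_le_right _ _)) (inv_nonneg.2 hΛ.le))
  have e : ((n : ℝ) * ε) ^ ((-q - 1) / q) = (((n : ℝ) * ε) ^ (1 + 1 / q))⁻¹ := by
    rw [← Real.rpow_neg hy.le]; congr 1; field_simp; ring
  rw [e] at h1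
  have hX : 0 < ((n : ℝ) * ε) ^ (1 + 1 / q) := Real.rpow_pos_of_pos hy _
  calc _ ≤ Λ * (Λ⁻¹ * ((((n : ℝ) * ε) ^ (1 + 1 / q))⁻¹ * (noiseNorm d σξ)⁻¹) * noiseNorm d σξ *
        (n * ε) ^ (1 + 1 / q)) := by gcongr
    _ = 1 := by field_simp

theorem SignalLearning.one_le_mul {d n m : ℕ} {q Λ : ℝ} {v : Vec d} {σξ ε η σ₀ : ℝ}
    (h : SignalLearning q Λ n m v σξ ε η σ₀) (hn : 0 < n) : 1 ≤ (n : ℝ) * ε := by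
  have hn' : (1 : ℝ) ≤ n := by exact_mod_cast hn
  have h1 := mul_le_mul_of_nonneg_left h.privacy_ge (by linarith : (0 : ℝ) ≤ n)
  rw [mul_one_div, Real.div_sqrt] at h1
  exact (Real.one_le_sqrt.2 hn').trans h1

theorem mul_le_of_le_privateBudget {d n m T : ℕ} {v : Vec d} {σξ ε η σ₀ P P' : ℝ} (hη : 0 < η)
    (hG : 0 < ‖v‖ + noiseNorm d σξ) (hP : P' ≤ P) (hε : 0 < ε) (hσ₀ : 0 < σ₀)
    (hT : (T : ℝ) ≤ P' * privateBudget n m v σξ ε η σ₀) :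
    T * η * (‖v‖ + noiseNorm d σξ) ≤ P * (m * n * ε * σ₀) := by
  have hμ : 1 ≤ max 1 (max ‖v‖ (noiseNorm d σξ)) := le_max_left _ _
  set μ := max 1 (max ‖v‖ (noiseNorm d σξ)) with hμd
  have h0 : 0 ≤ (m : ℝ) * n * ε * σ₀ := by positivity
  rw [privateBudget, ← hμd, mul_div_assoc', le_div_iff₀ (by positivity)] at hT
  have h1 : 0 ≤ T * η * (‖v‖ + noiseNorm d σξ) := by positivity
  calc T * η * (‖v‖ + noiseNorm d σξ) ≤ T * η * (‖v‖ + noiseNorm d σξ) * μ :=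
        le_mul_of_one_le_right h1 hμ
    _ = T * (η * μ * (‖v‖ + noiseNorm d σξ)) := by ring
    _ ≤ P' * (m * n * ε * σ₀) := hT
    _ ≤ _ := by gcongr

/-- Over the whole budget, the gradient steps move the correlations with the training noise by
less than their initial size. -/
theorem gradient_drift_le {n m T : ℕ} {q η ε σ₀ N P β Γ ρ X : ℝ} (hq : 2 < q) (hm : 0 < m)
    (hσ₀ : 0 < σ₀) (hN : 0 < N) (hP : 1 ≤ P) (hΓ : P ≤ Γ)
    (hρ : ρ = 2 * β * Γ * σ₀ * (β * N)) (hy : 1 ≤ (n : ℝ) * ε) (hX : n * ε ≤ X)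
    (hsmall : 2 * ρ * (q + 2) * X ≤ 1) (hT : T * η * N ≤ P * (m * n * ε * σ₀)) :
    T * (η * (1 / (m : ℝ) * (q * (2 * ρ) ^ (q - 1)))) * (β * N * (β * N)) ≤ ρ := by
  have hm' : (0 : ℝ) < m := by exact_mod_cast hm
  have hρ0 : 0 ≤ ρ := by
    have : ρ = 2 * β ^ 2 * Γ * σ₀ * N := by rw [hρ]; ring
    have : 0 ≤ Γ := by linarith
    rw [‹ρ = _›]; positivity
  have hqX : q * (n * ε) ≤ (q + 2) * X := by nlinarith
  have h2 : q * (n * ε) * (2 * ρ) ≤ 1 := by nlinarith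
  have h1 : 2 * ρ ≤ 1 := by
    have : 1 ≤ q * (n * ε) := by nlinarith
    nlinarith
  have h3 : (2 * ρ) ^ (q - 1) ≤ 2 * ρ := by
    simpa using Real.rpow_le_rpow_of_exponent_ge_of_imp (by linarith) h1
      (show (1 : ℝ) ≤ q - 1 by linarith) (by intro _ h; linarith)
  have h4 : q * (n * ε) * (2 * ρ) ^ (q - 1) ≤ 1 :=
    (mul_le_mul_of_nonneg_left h3 (by positivity)).trans h2
  have h5 : 0 ≤ (2 * ρ) ^ (q - 1) := by positivity
  calc _ = T * η * N * (1 / m * (q * (2 * ρ) ^ (q - 1)) * (β ^ 2 * N)) := by ring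
    _ ≤ P * (m * n * ε * σ₀) * (1 / m * (q * (2 * ρ) ^ (q - 1)) * (β ^ 2 * N)) := by gcongr
    _ = q * (n * ε) * (2 * ρ) ^ (q - 1) * (P * σ₀ * β ^ 2 * N) := by field_simp
    _ ≤ 1 * (P * σ₀ * β ^ 2 * N) := by gcongr
    _ ≤ 2 * (Γ * σ₀ * β ^ 2 * N) := by
      have : P * (σ₀ * β ^ 2 * N) ≤ Γ * (σ₀ * β ^ 2 * N) := by gcongr
      have : 0 ≤ P * (σ₀ * β ^ 2 * N) := by positivity
      linarith
    _ = ρ := by rw [hρ]; ring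

instance {d n m : ℕ} (v : Vec d) (σξ σ₀ : ℝ) (ν : Measure (Weights d m)) [IsProbabilityMeasure ν] :
    IsProbabilityMeasure (runLaw n v σξ σ₀ ν) := by
  unfold runLaw; infer_instance

/-- Subadditivity of the outer measure, so that neither `A` nor `p` has to be measurable. -/
theorem one_sub_le_measureReal {Ω : Type*} {mΩ : MeasurableSpace Ω} {μ : Measure Ω}
    [IsProbabilityMeasure μ] {p : Ω → Prop} {A : Set Ω} {b : ℝ} (hA : ∀ ω, p ω → ω ∈ A)
    (hb : μ.real {ω | ¬ p ω} ≤ b) : 1 - b ≤ μ.real A := by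
  have h1 : μ.real Set.univ ≤ μ.real A + μ.real {ω | ¬ p ω} :=
    (measureReal_mono fun ω _ => (em (p ω)).imp (hA ω) id).trans (measureReal_union_le _ _)
  rw [probReal_univ] at h1
  linarith

end PrivateCNN

theorem corollary4p8 (q : ℝ) (hq : 2 < q) (C₀ : ℝ) (hC₀ : 0 < C₀) :
    ∃ C : ℝ, 0 < C ∧ ∀ B : ℝ, 0 < B → ∃ K : ℝ, 0 < K ∧
      ∀ (d n m T : ℕ) (v : PrivateCNN.Vec d) (σξ ε δ η σ₀ Cs κ : ℝ)
        (ν : MeasureTheory.Measure (PrivateCNN.Weights d m))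
        [MeasureTheory.IsProbabilityMeasure ν],
        -- the conditions of signal learning
        PrivateCNN.SignalLearning q (PrivateCNN.polylog K d) n m v σξ ε η σ₀ →
        PrivateCNN.polylog K d ≤ PrivateCNN.snr v σξ * (n * ε) →
        PrivateCNN.polylog K d ≤ ((n : ℝ) * ε) ^ (1 + 1 / q) →
        -- the privacy noise is that of the Gaussian mechanism, at every filter
        0 < δ → δ < 1 → Real.log (1 / δ) ≤ PrivateCNN.polylog B d →
        0 < Cs → Cs ≤ PrivateCNN.polylog B d →
        (∀ a, ν.map (fun z => z a) =
          PrivateCNN.isoGaussian d (PrivateCNN.privacyStd n m T v σξ ε δ Cs)) →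
        -- the number of iterations respects the private budget
        (T : ℝ) ≤ PrivateCNN.polylog B d * PrivateCNN.privateBudget n m v σξ ε η σ₀ →
        0 < κ →
        1 - 1 / (d : ℝ) ≤ (PrivateCNN.runLaw n v σξ σ₀ ν).real
          {ω | ∀ t ≤ T,
            PrivateCNN.trainLoss q ω.1 (PrivateCNN.iterate q η ω t) ≤ C₀ * κ →
            PrivateCNN.testError q v σξ (PrivateCNN.iterate q η ω t) ≤
                C * (κ + Real.exp (-((n : ℝ) * ε) ^ (1 + 1 / q))) ∧
            PrivateCNN.testRisk q v σξ (PrivateCNN.iterate q η ω t) ≤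
                ENNReal.ofReal (C * (κ + Real.exp (-((n : ℝ) * ε) ^ (1 + 1 / q))))} := by
  open PrivateCNN in
  have hqq : 0 < q ^ q := Real.rpow_pos_of_pos (by linarith) q
  set C₁ : ℝ := 4 * Real.exp 4 * C₀ + 8 * q ^ q with hC₁
  have hC₁0 : 0 < C₁ := by positivity
  refine ⟨2 * C₁, by positivity, fun B hB => ?_⟩
  set B' := max B 1 with hB'
  have hB'1 : 1 ≤ B' := le_max_right _ _
  refine ⟨max (1600 * (q + 2) * B' ^ 4) (4 * B' + 2), lt_max_of_lt_right (by linarith), ?_⟩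
  intro d n m T v σξ ε δ η σ₀ Cs κ ν _ hSL _ _ hδ _ hδB hCs hCsB hν hT hκ
  set Λ := polylog (max (1600 * (q + 2) * B' ^ 4) (4 * B' + 2)) d with hΛ
  have hσ := hSL.noise_pos
  have hη := hSL.lr_pos
  have hσ₀ := hSL.init_pos
  have hε := hSL.privacy_pos
  have hv := hSL.signal_ne_zero
  have hd : 0 < d := by
    rcases Nat.eq_zero_or_pos d with rfl | h
    · exact absurd (Subsingleton.elim v 0) hv
    · exact h
  set L := 1 + Real.log d with hL
  have hL1 : 1 ≤ L := one_le_one_add_log hd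
  set P := polylog B' d with hPdef
  have hP1 : 1 ≤ P := one_le_polylog hB'1 hd
  have hBP : polylog B d ≤ P := polylog_mono hB.le (le_max_left _ _) hd
  have hΛge : 1600 * (q + 2) * L ^ 2 * P ^ 4 ≤ Λ := mul_polylog_pow_le _ hB'1 hd
  have hP3 : 1 ≤ P ^ 3 := one_le_pow₀ hP1
  have hP4 : 1 ≤ P ^ 4 := one_le_pow₀ hP1
  have hL2 : 1 ≤ L ^ 2 := one_le_pow₀ hL1
  have hΛL : 1600 * L ^ 2 ≤ Λ := by
    refine le_trans ?_ hΛge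
    have h1 : 1600 * L ^ 2 ≤ 1600 * (q + 2) * L ^ 2 := by nlinarith
    exact h1.trans (le_mul_of_one_le_right (by positivity) hP4)
  have hΛ1 : 1 ≤ Λ := by linarith
  have hn : 0 < n := by exact_mod_cast (by linarith [hSL.samples_ge] : (0 : ℝ) < n)
  have hm : 0 < m := by exact_mod_cast (by linarith [hSL.width_ge] : (0 : ℝ) < m)
  have hN : 0 < noiseNorm d σξ := by
    have : (0 : ℝ) < d := by exact_mod_cast hd
    rw [noiseNorm]; positivity
  have hG : 0 < ‖v‖ + noiseNorm d σξ := by positivity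
  have hy := hSL.one_le_mul hn
  set X := ((n : ℝ) * ε) ^ (1 + 1 / q) with hXdef
  have hyX : n * ε ≤ X := by
    have hq' : 0 < 1 / q := by positivity
    have := Real.rpow_le_rpow_of_exponent_le hy (show (1 : ℝ) ≤ 1 + 1 / q by linarith)
    rwa [Real.rpow_one] at this
  have hX1 : 1 ≤ X := hy.trans hyX
  have hTG := mul_le_of_le_privateBudget hη hG hBP hε hσ₀ hT
  set β := 10 * L with hβ
  set Γ := 4 * P ^ 3 with hΓ
  set R := β * noiseNorm d σξ with hR
  set ρ := 2 * β * Γ * σ₀ * R with hρ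
  have hPΓ : P ≤ Γ := by
    have : P * 1 ≤ P * P ^ 2 := by gcongr; exact one_le_pow₀ hP1
    have : P * P ^ 2 = P ^ 3 := by ring
    linarith
  have hρ0 : 0 ≤ ρ := by positivity
  -- This is where the size of `Λ` is used: it beats `4 β ^ 2 Γ (q + 2) P`.
  have hsmall : 2 * ρ * (q + 2) * X ≤ 1 := by
    refine le_trans ?_ (hSL.init_mul_le (by linarith) (by linarith) hn hN)
    calc 2 * ρ * (q + 2) * X
        = 1600 * (q + 2) * L ^ 2 * P ^ 3 * (σ₀ * noiseNorm d σξ * X) := by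
          rw [hρ, hR, hΓ, hβ]; ring
      _ ≤ Λ * (σ₀ * noiseNorm d σξ * X) := by
          have h1 : P ^ 3 ≤ P ^ 4 := pow_le_pow_right₀ hP1 (by norm_num)
          gcongr
          exact (mul_le_mul_of_nonneg_left h1 (by positivity)).trans hΛge
  have hρX : 2 * ρ * (X + 1) ≤ 1 := by
    refine le_trans ?_ hsmall
    rw [mul_assoc (2 * ρ)]
    refine mul_le_mul_of_nonneg_left ?_ (by positivity)
    nlinarith
  have hρ1 : 2 * ρ ≤ 1 := 
    (le_mul_of_one_le_right (by positivity) (by linarith : 1 ≤ X + 1)).trans hρX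
  have hstep := gradient_drift_le hq hm hσ₀ hN hP1 hPΓ hρ hy hyX hsmall
    (le_trans (by gcongr; linarith [norm_nonneg v]) hTG)
  have hgood : ∀ ω : Run d n m, TypicalRun v β R σ₀ (Γ * σ₀ / η) T ω → ∀ t ≤ T,
      trainLoss q ω.1 (iterate q η ω t) ≤ C₀ * κ →
      testError q v σξ (iterate q η ω t) ≤ 2 * C₁ * (κ + Real.exp (-X)) ∧
      testRisk q v σξ (iterate q η ω t) ≤ ENNReal.ofReal (2 * C₁ * (κ + Real.exp (-X))) := by
    intro ω hω t ht hloss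
    obtain ⟨hin, hperp⟩ := hω.iterate_bounds (by linarith) hη (by linarith) (by linarith) hσ₀ hσ hd
      hR hρ hstep ht
    have hrisk := testRisk_le (σξ := σξ) (X := X) (by linarith) (by linarith) hn hv hω.data.signal
      (iterate q η ω t) hω.data.balanced (fun a i => (hin a i).trans hρ1) (fun a => by
        obtain ⟨α, hα⟩ := hperp a
        refine ⟨α, ?_⟩
        rw [← mul_pow]
        refine pow_le_one₀ (by positivity) (le_trans ?_ hρX)
        gcongr) hloss
    have hle : 4 * Real.exp 4 * (C₀ * κ) + 8 * q ^ q * Real.exp (-X) ≤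
        C₁ * (κ + Real.exp (-X)) := by
      rw [hC₁]
      have h1 : 0 ≤ 4 * Real.exp 4 * C₀ * Real.exp (-X) := by positivity
      have h2 : 0 ≤ 8 * q ^ q * κ := by positivity
      linarith
    have hrisk' := hrisk.trans (ENNReal.ofReal_le_ofReal hle)
    have hpos : 0 ≤ C₁ * (κ + Real.exp (-X)) := by positivity
    constructor
    · rw [mul_assoc]
      exact testError_le_of_testRisk_le hpos hrisk'
    · exact hrisk'.trans (ENNReal.ofReal_le_ofReal (by linarith))
  have hbad := runLaw_not_typicalRun_le (n := n) hv hσ hd (β := β) (by linarith)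
    (by have : 4 * β ^ 2 = 400 * L ^ 2 := by rw [hβ]; ring
        linarith [hSL.samples_ge]) hν hσ₀ (S := Γ * σ₀ / η) (by positivity)
    (mul_privacyStd_sq_le hn hm hG hε hη hσ₀ hP1 hCs (hCsB.trans hBP) hδ (hδB.trans hBP) hTG)
  have hbad' : (runLaw n v σξ σ₀ ν).real {ω | ¬ TypicalRun v β R σ₀ (Γ * σ₀ / η) T ω} ≤
      1 / (d : ℝ) := by
    obtain ⟨hnd, hmd⟩ := hSL.samples_le_dim hΛ1
    rw [measureReal_def]
    refine ENNReal.toReal_le_of_le_ofReal (by positivity) (hbad.trans ?_)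
    have e : ((n : ℝ≥0∞) * d + 1 + 4 * m * (n + d)) =
        ENNReal.ofReal (n * d + 1 + 4 * m * (n + d)) := by
      rw [show (n * d + 1 + 4 * m * (n + d) : ℝ) = ((n * d + 1 + 4 * m * (n + d) : ℕ) : ℝ) by
        push_cast; ring, ENNReal.ofReal_natCast]
      push_cast; ring
    rw [e, ← ENNReal.ofReal_mul (by positivity)]
    exact ENNReal.ofReal_le_ofReal (failure_probability_le hd hnd hmd)
  exact one_sub_le_measureReal hgood hbad'
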